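/- Let $S^1=\Delta[1]/\partial\Delta[1]$ be the simplicial circle, with base point $*$ the image of $\partial\Delta[1]$. Let $F(S^1)$ be Milnor's construction: the simplicial group with $F(S^1)_n$ the free group on the set $S^1_n$ modulo the relation $*=1$. Let $K(S^1)$ be Cohen's construction: the quotient simplicial group of $F(S^1)$ by the normal simplicial subgroup generated by all iterated commutators $[[\cdots[[x_1,x_2],x_3],\cdots],x_t]$ with $x_1,\dots,x_t\in S^1_n$ ($n\ge 0$, $t\geq 2$) such that $x_i=x_j$ for some $1\le i<j\le t$. Let $p\colon F(S^1)\to K(S^1)$ be the quotient homomorphism. A simplicial group $G$ is called minimal if its underlying simplicial set is minimal, that is, it is a Kan complex and, for all $n\ge 0$, all $0\le k\le n+1$ and all $x,y\in G_{n+1}$, if $d_ix=d_iy$ for all $i\ne k$, then $d_kx=d_ky$. The boundaries of $G$ are the elements of $d_0\bigl(\bigcap_{j=1}^{n+1}\ker(d_j\colon G_{n+1}\to G_n)\bigr)\subseteq G_n$, $n\ge 0$. **Theorem 6.12.** $K(S^1)$ is the universal minimal simplicial quotient group of $F(S^1)$, in the following sense: 1. $K(S^1)$ is a minimal simplicial group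 (and $p$ is surjective in every degree). 2. For every minimal simplicial group $G$, every simplicial homomorphism $f\colon F(S^1)\to G$ factors, uniquely, through $p$: there is exactly one simplicial homomorphism $g\colon K(S^1)\to G$ with $g\circ p=f$. Moreover, $K(S^1)$ is the quotient of $F(S^1)$ by the normal simplicial subgroup $\overline{B}$ generated by the boundaries of $F(S^1)$: there is an isomorphism of simplicial groups $e\colon K(S^1)\to F(S^1)/\overline{B}$ such that $e\circ p$ is the quotient homomorphism $F(S^1)\to F(S^1)/\overline{B}$. -/

import Mathlib

open CategoryTheory Simplicial Opposite
open scoped commutatorElement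

universe u

/-- Simplicial groups and their simplicial homomorphisms. -/
abbrev SimplicialGroup : Type (u + 1) := SimplicialObject GrpCat.{u}

/-- A minimal simplicial set: a Kan complex in which two simplices of the same positive dimension
that agree on all faces but the `k`-th one also agree on the `k`-th face. -/
structure IsMinimalSSet (X : SSet.{u}) : Prop where
  kan : SSet.KanComplex X
  face_eq : ∀ (n : ℕ) (k : Fin (n + 2)) (x y : X _⦋n + 1⦌),
    (∀ i : Fin (n + 2), i ≠ k → X.δ i x = X.δ i y) → X.δ k x = X.δ k y

namespace SimplicialGroup

/-- The underlying simplicial set of a simplicial group. -/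
abbrev toSSet (G : SimplicialGroup.{u}) : SSet.{u} := G ⋙ forget GrpCat.{u}

/-- A simplicial group is minimal if its underlying simplicial set is. -/
def IsMinimal (G : SimplicialGroup.{u}) : Prop := IsMinimalSSet G.toSSet

/-- Normal simplicial subgroups of `G`. -/
@[ext]
structure NormalSub (G : SimplicialGroup.{u}) where
  carrier : ∀ k : SimplexCategoryᵒᵖ, Subgroup (G.obj k)
  normal : ∀ k, (carrier k).Normal
  map_mem : ∀ {k l : SimplexCategoryᵒᵖ} (f : k ⟶ l) (x : G.obj k),
    x ∈ carrier k → (G.map f).hom x ∈ carrier l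

attribute [instance] NormalSub.normal

namespace NormalSub

variable {G : SimplicialGroup.{u}}

/-- The normal simplicial subgroup generated by sets `S n` of `n`-simplices: in each degree, the
normal closure of the images of these simplices under all simplicial operators. -/
def generated (S : ∀ n : ℕ, Set (G _⦋n⦌)) : G.NormalSub where
  carrier k := Subgroup.normalClosure
    {g | ∃ (n : ℕ) (f : op ⦋n⦌ ⟶ k) (s : G _⦋n⦌), s ∈ S n ∧ g = (G.map f).hom s}
  normal _ := Subgroup.normalClosure_normal
  map_mem {k l} f x hx := by
    have h : Subgroup.normalClosure
        {g | ∃ (n : ℕ) (f : op ⦋n⦌ ⟶ k) (s : G _⦋n⦌), s ∈ S n ∧ g = (G.map f).hom s} ≤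
        (Subgroup.normalClosure
          {g | ∃ (n : ℕ) (f : op ⦋n⦌ ⟶ l) (s : G _⦋n⦌), s ∈ S n ∧
            g = (G.map f).hom s}).comap (G.map f).hom := by
      refine Subgroup.normalClosure_le_normal ?_
      rintro _ ⟨n, g, s, hs, rfl⟩
      refine Subgroup.subset_normalClosure ⟨n, g ≫ f, s, hs, ?_⟩
      simp
    exact h hx

/-- `generated S` contains `S` ... -/
theorem subset_generated (S : ∀ n : ℕ, Set (G _⦋n⦌)) (n : ℕ) :
    S n ⊆ ((generated S).carrier (op ⦋n⦌) : Set (G _⦋n⦌)) := fun s hs =>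
  Subgroup.subset_normalClosure ⟨n, 𝟙 _, s, hs, by simp⟩

/-- ... and is contained in every normal simplicial subgroup that contains `S`. -/
theorem generated_le (S : ∀ n : ℕ, Set (G _⦋n⦌)) (N : G.NormalSub)
    (hN : ∀ n, S n ⊆ (N.carrier (op ⦋n⦌) : Set (G _⦋n⦌))) (k : SimplexCategoryᵒᵖ) :
    (generated S).carrier k ≤ N.carrier k := by
  refine Subgroup.normalClosure_le_normal ?_
  rintro _ ⟨n, f, s, hs, rfl⟩
  exact N.map_mem f s (hN n hs)

/-- The quotient simplicial group `G / N`. -/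
def quotient (N : G.NormalSub) : SimplicialGroup.{u} where
  obj k := GrpCat.of (G.obj k ⧸ N.carrier k)
  map {k l} f := GrpCat.ofHom
    (QuotientGroup.map (N.carrier k) (N.carrier l) (G.map f).hom (N.map_mem f))
  map_id k := by
    ext x
    simp
  map_comp f g := by
    ext x
    simp only [GrpCat.hom_comp, GrpCat.hom_ofHom, MonoidHom.coe_comp, Function.comp_apply,
      QuotientGroup.coe_mk', QuotientGroup.map_mk, Functor.map_comp]
    rfl

/-- The quotient homomorphism `G ⟶ G / N`. -/
def proj (N : G.NormalSub) : G ⟶ N.quotient where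
  app k := GrpCat.ofHom (QuotientGroup.mk' (N.carrier k))
  naturality _ _ _ := rfl

end NormalSub

/-- The group `N G_{n+1}` of the Moore complex: the common kernel of all faces but `d₀`. -/
def moore (G : SimplicialGroup.{u}) (n : ℕ) : Subgroup (G _⦋n + 1⦌) :=
  ⨅ (i : Fin (n + 2)) (_ : i ≠ 0), (G.δ i).hom.ker

/-- The boundaries `d₀ (N G_{n+1}) ⊆ G_n`. -/
def boundaries (G : SimplicialGroup.{u}) (n : ℕ) : Subgroup (G _⦋n⦌) :=
  (G.moore n).map (G.δ 0).hom

/-- The normal simplicial subgroup generated by the boundaries in all degrees. -/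
def boundaryClosure (G : SimplicialGroup.{u}) : G.NormalSub :=
  NormalSub.generated fun n => (G.boundaries n : Set (G _⦋n⦌))

/-- The simplicial group which is the free group on `X_n` in degree `n`. -/
def free (X : SSet.{u}) : SimplicialGroup.{u} := X ⋙ GrpCat.free

/-- The generator of `free X` given by a simplex. -/
def freeOf (X : SSet.{u}) {n : ℕ} (x : X _⦋n⦌) : (free X) _⦋n⦌ := FreeGroup.of x

/-- The base point in degree `n` (the degenerate simplex on the base vertex `x₀`). -/
def basePoint (X : SSet.{u}) (x₀ : X _⦋0⦌) (n : ℕ) : X _⦋n⦌ :=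
  X.map (SimplexCategory.const ⦋n⦌ ⦋0⦌ 0).op x₀

/-- The normal simplicial subgroup of `free X` generated by the base points. -/
def milnorRel (X : SSet.{u}) (x₀ : X _⦋0⦌) : (free X).NormalSub :=
  NormalSub.generated fun n => {freeOf X (basePoint X x₀ n)}

/-- Milnor's construction `F(X)` for a simplicial set `X` with base vertex `x₀`: in degree `n`,
the free group on `X_n` modulo the relation that the base point is `1`. -/
def milnorF (X : SSet.{u}) (x₀ : X _⦋0⦌) : SimplicialGroup.{u} := (milnorRel X x₀).quotient

/-- The generator of `F(X)` given by a simplex of `X`. -/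
def milnorOf (X : SSet.{u}) (x₀ : X _⦋0⦌) {n : ℕ} (x : X _⦋n⦌) : (milnorF X x₀) _⦋n⦌ :=
  ((milnorRel X x₀).proj.app (op ⦋n⦌)).hom (freeOf X x)

/-- The left-normed commutator `[[…[[a₁, a₂], a₃], …], a_t]` of a list of group elements. -/
def leftNormed {H : Type*} [Group H] (as : List H) : H :=
  match as with
  | [] => 1
  | a :: l => l.foldl (fun b c => ⁅b, c⁆) a

/-- The normal simplicial subgroup of `F(X)` generated by the left-normed commutators of
`x₁, …, x_t ∈ X_n` in which some simplex occurs at least twice (`n`, `t` arbitrary). -/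
def cohenRel (X : SSet.{u}) (x₀ : X _⦋0⦌) : (milnorF X x₀).NormalSub :=
  NormalSub.generated fun n =>
    {g | ∃ (t : ℕ) (x : Fin t → X _⦋n⦌), (∃ i j : Fin t, i < j ∧ x i = x j) ∧
      g = leftNormed (List.ofFn fun i => milnorOf X x₀ (x i))}

/-- Cohen's construction `K(X)`. -/
def cohenK (X : SSet.{u}) (x₀ : X _⦋0⦌) : SimplicialGroup.{u} := (cohenRel X x₀).quotient

/-- The quotient homomorphism `F(X) ⟶ K(X)`. -/
def cohenProj (X : SSet.{u}) (x₀ : X _⦋0⦌) : milnorF X x₀ ⟶ cohenK X x₀ := (cohenRel X x₀).proj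

end SimplicialGroup

/-- The equivalence relation on `X_k` that identifies all simplices of the subcomplex `A`. -/
def collapseSetoid {X : SSet.{u}} (A : X.Subcomplex) (k : SimplexCategoryᵒᵖ) :
    Setoid (X.obj k) where
  r x y := x = y ∨ (x ∈ A.obj k ∧ y ∈ A.obj k)
  iseqv :=
    { refl := fun _ => Or.inl rfl
      symm := by
        rintro x y (h | h)
        exacts [Or.inl h.symm, Or.inr h.symm]
      trans := by
        rintro x y z (rfl | h) (rfl | h')
        exacts [Or.inl rfl, Or.inr h', Or.inr h, Or.inr ⟨h.1, h'.2⟩] }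

/-- The quotient simplicial set `X / A`, for a subcomplex `A` of `X`. -/
def collapse {X : SSet.{u}} (A : X.Subcomplex) : SSet.{u} where
  obj k := Quotient (collapseSetoid A k)
  map {k l} f := TypeCat.ofHom (Quotient.map (X.map f) (by
    rintro x y (rfl | h)
    · exact Or.inl rfl
    · exact Or.inr ⟨A.map f h.1, A.map f h.2⟩))
  map_id k := by
    ext x
    induction x using Quotient.inductionOn with
    | h x => simp
  map_comp f g := by
    ext x
    induction x using Quotient.inductionOn with
    | h x => simp

/-- The simplicial circle `S¹ = Δ[1] / ∂Δ[1]`. -/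
def simplicialCircle : SSet.{u} := collapse (SSet.boundary.{u} 1)

/-- The base vertex of the circle: the class of the vertices of `Δ[1]`. -/
def circleBase : simplicialCircle.{u} _⦋0⦌ :=
  Quotient.mk (collapseSetoid (SSet.boundary.{u} 1) (op ⦋0⦌))
    (SSet.stdSimplex.objEquiv.symm (SimplexCategory.const ⦋0⦌ ⦋1⦌ 0))

/-- `F(S¹)`. -/
abbrev FCircle : SimplicialGroup.{u} := SimplicialGroup.milnorF simplicialCircle.{u} circleBase

/-- `K(S¹)`. -/
abbrev KCircle : SimplicialGroup.{u} := SimplicialGroup.cohenK simplicialCircle.{u} circleBase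

/-- The quotient homomorphism `F(S¹) ⟶ K(S¹)`. -/
abbrev circleProj : FCircle.{u} ⟶ KCircle.{u} :=
  SimplicialGroup.cohenProj simplicialCircle.{u} circleBase

/-! Everything reduces to one equality of normal simplicial subgroups of F(S¹): Cohen's relations
generate the same subgroup as the boundaries (`Circle.cohenRel_eq_bd`). A quotient by boundaries is
always minimal, and a homomorphism to a minimal simplicial group always kills boundaries, so the
universal property follows formally.

Two facts about groups are used. Killing left-normed commutators with a repeated entry amounts to
making the normal closure of each generator commutative. The resulting reduced free group embeds, by
Milnor, into the units of the Magnus ring of noncommutative polynomials in which monomials with a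
repeated letter vanish (`Magnus.map_eq_one_of_expansion_eq`).

In degree n the circle has letters y_1, …, y_n besides the base point. The face d_0 kills y_1, the
last face from degree n+1 kills y_{n+1}, and an inner face d_i identifies y_i with y_{i+1}. If an
inner face of z has trivial expansion, coefficients of words exchanged by y_i ↔ y_{i+1} cancel, so
when every word of z contains one of these two letters, every word contains the other.

Boundaries are Cohen relations: if all faces of z but d_0 are trivial in K(S¹), the last face shows
that every word contains y_{n+1}, the inner faces carry this down to y_1, and d_0 kills y_1. By
injectivity d_0 z = 1 (`Circle.facesTrivial_KCircle`).

Cohen relations are boundaries: modulo boundaries, the normal closure of each generator is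
commutative, by induction on the degree (`Circle.gensCommute`). An element of the normal closure of
y_b is corrected by degenerate elements, which commute with y_b by induction, until its inner faces
vanish. Its words all contain y_b, hence every letter, so the outer faces vanish too and it is a
cycle. In a minimal quotient cycles commute with all generators (`Circle.commute_gen_of_cycle`). -/

/-! ### Left-normed commutators and commutative normal closures. -/

section LeftNormed

open SimplicialGroup

variable {H : Type*} [Group H] {ι : Type*}

theorem leftNormed_concat {l : List H} (hl : l ≠ []) (c : H) :
    leftNormed (l ++ [c]) = ⁅leftNormed l, c⁆ := by
  cases l with
  | nil => exact absurd rfl hl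
  | cons a l => simp [leftNormed]

theorem map_leftNormed {H' : Type*} [Group H'] (f : H →* H') (l : List H) :
    f (leftNormed l) = leftNormed (l.map f) := by
  induction l using List.reverseRecOn with
  | nil => simp [leftNormed]
  | append_singleton l c ih =>
    rcases eq_or_ne l [] with rfl | hl
    · simp [leftNormed]
    · rw [leftNormed_concat hl, List.map_append, List.map_singleton,
        leftNormed_concat (by simpa using hl), map_commutatorElement, ih]

theorem commutatorElement_mem_left {N : Subgroup H} [N.Normal] {u : H} (hu : u ∈ N) (c : H) :
    ⁅u, c⁆ ∈ N := by
  rw [commutatorElement_def, mul_assoc, mul_assoc, ← mul_assoc c]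
  exact N.mul_mem hu (Subgroup.Normal.conj_mem inferInstance _ (N.inv_mem hu) c)

theorem commutatorElement_mem_right {N : Subgroup H} [N.Normal] {u : H} (hu : u ∈ N) (c : H) :
    ⁅c, u⁆ ∈ N := by
  rw [← commutatorElement_inv]
  exact N.inv_mem (commutatorElement_mem_left hu c)

theorem leftNormed_mem_of_mem {y : ι → H} {b : ι} {T : Subgroup H} [T.Normal] (hT : y b ∈ T)
    {l : List ι} (hb : b ∈ l) : leftNormed (l.map y) ∈ T := by
  induction l using List.reverseRecOn with
  | nil => simp at hb
  | append_singleton l c ih =>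
    rcases eq_or_ne l [] with rfl | hl
    · obtain rfl : b = c := by simpa using hb
      simpa [leftNormed] using hT
    · rw [List.map_append, List.map_singleton, leftNormed_concat (by simpa using hl)]
      rcases List.mem_append.1 hb with h | h
      · exact commutatorElement_mem_left (ih h) _
      · obtain rfl : b = c := by simpa using h
        exact commutatorElement_mem_right hT _

/-- Left-normed commutators with a repeated entry lie in `L` if each entry `y b` lies in a normal
subgroup that is commutative modulo `L`. -/
theorem leftNormed_mem_of_not_nodup {y : ι → H} {L : Subgroup H} [L.Normal] (T : ι → Subgroup H)
    [∀ b, (T b).Normal] (hT : ∀ b, y b ∈ T b) (hL : ∀ b, ∀ u ∈ T b, ∀ v ∈ T b, ⁅u, v⁆ ∈ L)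
    {l : List ι} (hl : ¬ l.Nodup) : leftNormed (l.map y) ∈ L := by
  induction l using List.reverseRecOn with
  | nil => simp at hl
  | append_singleton l c ih =>
    rcases eq_or_ne l [] with rfl | h0
    · simp at hl
    · rw [List.map_append, List.map_singleton, leftNormed_concat (by simpa using h0)]
      by_cases h : l.Nodup
      · have hc : c ∈ l := by
          by_contra hc
          exact hl (by simpa [List.nodup_append, h] using fun a ha (e : a = c) => hc (e ▸ ha))
        exact hL c _ (leftNormed_mem_of_mem (hT c) hc) _ (hT c)
      · exact commutatorElement_mem_left (ih h) _

/-- If all left-normed commutators of generators with a repeated entry are trivial, then the normal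
closure of each generator is commutative. -/
theorem commute_of_mem_normalClosure {y : ι → H} (hy : Subgroup.closure (Set.range y) = ⊤)
    (h : ∀ l : List ι, ¬ l.Nodup → leftNormed (l.map y) = 1) (b : ι) {u v : H}
    (hu : u ∈ Subgroup.normalClosure {y b}) (hv : v ∈ Subgroup.normalClosure {y b}) :
    Commute u v := by
  let e : List ι → H := fun l => leftNormed ((b :: l).map y)
  have e_concat (l : List ι) (c : ι) : e (l ++ [c]) = ⁅e l, y c⁆ := by
    change leftNormed (((b :: l) ++ [c]).map y) = _
    rw [List.map_append, List.map_singleton, leftNormed_concat (by simp)]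
  let C : Subgroup H := Subgroup.closure (Set.range e)
  have he (l : List ι) : e l ∈ C := Subgroup.subset_closure ⟨l, rfl⟩
  have conj (c : ι) (l : List ι) : y c * e l * (y c)⁻¹ ∈ C ∧ (y c)⁻¹ * e l * y c ∈ C := by
    -- The entry `c` occurs twice, so `⁅e l, y c⁆` commutes with `y c`. This expresses both
    -- conjugates of `e l` by `y c` through `e l` and `⁅e l, y c⁆`.
    have h2 : ⁅⁅e l, y c⁆, y c⁆ = 1 := by
      rw [← e_concat, ← e_concat]
      refine h _ ?_
      simp [List.nodup_append]
    have h1 : ⁅e l, y c⁆ ∈ C := e_concat l c ▸ he _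
    rw [commutatorElement_eq_one_iff_mul_comm] at h2
    constructor
    · convert C.mul_mem (C.inv_mem h1) (he l) using 1
      simp [commutatorElement_def, mul_assoc]
    · convert C.mul_mem h1 (he l) using 1
      have h3 : ⁅e l, y c⁆ = (y c)⁻¹ * ⁅e l, y c⁆ * y c := by
        rw [mul_assoc, h2, inv_mul_cancel_left]
      rw [h3]
      simp [commutatorElement_def, mul_assoc]
  have conjC (c : ι) : ∀ x ∈ C, y c * x * (y c)⁻¹ ∈ C ∧ (y c)⁻¹ * x * y c ∈ C := by
    intro x hx
    induction hx using Subgroup.closure_induction with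
    | mem x hx => obtain ⟨l, rfl⟩ := hx; exact conj c l
    | one => simp [C.one_mem]
    | mul x z _ _ hx hz =>
      refine ⟨?_, ?_⟩
      · convert C.mul_mem hx.1 hz.1 using 1; group
      · convert C.mul_mem hx.2 hz.2 using 1; group
    | inv x _ hx =>
      refine ⟨?_, ?_⟩
      · convert C.inv_mem hx.1 using 1; group
      · convert C.inv_mem hx.2 using 1; group
  have hN : C.Normal := by
    refine ⟨fun x hx g => ?_⟩
    have hg : g ∈ Subgroup.closure (Set.range y) := hy ▸ Subgroup.mem_top g
    suffices ∀ x ∈ C, g * x * g⁻¹ ∈ C ∧ g⁻¹ * x * g ∈ C from (this x hx).1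
    induction hg using Subgroup.closure_induction with
    | mem g hg => obtain ⟨c, rfl⟩ := hg; exact conjC c
    | one => intro x hx; simpa using hx
    | mul g k _ _ hg hk =>
      intro x hx
      refine ⟨?_, ?_⟩
      · convert (hg _ (hk x hx).1).1 using 1; group
      · convert (hk _ (hg x hx).2).2 using 1; group
    | inv g _ hg =>
      intro x hx
      simpa using (hg x hx).symm
  have hle : Subgroup.normalClosure {y b} ≤ C := by
    refine Subgroup.normalClosure_le_normal ?_
    rintro _ rfl
    exact he []
  have hcent : C ≤ Subgroup.centralizer {y b} := by
    refine (Subgroup.closure_le _).2 ?_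
    rintro _ ⟨l, rfl⟩
    rw [SetLike.mem_coe, Subgroup.mem_centralizer_singleton_iff]
    have h1 : ⁅e l, y b⁆ = 1 := by
      rw [← e_concat]
      exact h _ (by simp)
    rw [commutatorElement_eq_one_iff_mul_comm] at h1
    exact h1
  have hle2 : Subgroup.normalClosure {y b} ≤
      Subgroup.centralizer (Subgroup.normalClosure {y b} : Set H) := by
    refine Subgroup.normalClosure_le_normal ?_
    rintro _ rfl
    rw [SetLike.mem_coe, Subgroup.mem_centralizer_iff]
    intro x hx
    have := hcent (hle hx)
    rw [Subgroup.mem_centralizer_singleton_iff] at this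
    exact this
  exact (Subgroup.mem_centralizer_iff.1 (hle2 hv)) u hu

end LeftNormed

/-! ### The reduced Magnus representation. -/

namespace Magnus

variable {α β : Type*}

/-- Left multiplication by a letter on the free abelian group on words, where words with a repeated
letter are set to zero. -/
noncomputable def letter (a : α) : Module.End ℤ (List α →₀ ℤ) :=
  open Classical in
  Finsupp.linearCombination ℤ fun w => if a ∈ w then 0 else Finsupp.single (a :: w) 1

theorem letter_single_of_mem {a : α} {w : List α} (h : a ∈ w) (c : ℤ) :
    letter a (Finsupp.single w c) = 0 := by
  simp [letter, h]

theorem letter_single_of_notMem {a : α} {w : List α} (h : a ∉ w) (c : ℤ) :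
    letter a (Finsupp.single w c) = Finsupp.single (a :: w) c := by
  simp [letter, h]

theorem letter_mul_letter (a : α) : letter a * letter a = 0 := by
  ext w : 1
  by_cases h : a ∈ w
  · ext
    simp [letter_single_of_mem h]
  · ext
    simp [letter_single_of_notMem h, letter_single_of_mem]

/-- The unit `1 + a` for a letter `a`. -/
noncomputable def letterUnit (a : α) : (Module.End ℤ (List α →₀ ℤ))ˣ where
  val := 1 + letter a
  inv := 1 - letter a
  val_inv := by
    rw [mul_sub, mul_one, add_mul, letter_mul_letter]
    simp
  inv_val := by
    rw [mul_add, mul_one, sub_mul, letter_mul_letter]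
    simp

/-- The Magnus representation of the free group on `α`, where the base point `x₀` acts trivially. -/
noncomputable def rep (x₀ : α) : FreeGroup α →* (Module.End ℤ (List α →₀ ℤ))ˣ :=
  open Classical in
  FreeGroup.lift fun a => if a = x₀ then 1 else letterUnit a

/-- The action of a group element on the free abelian group on words. -/
noncomputable def act (x₀ : α) (z : FreeGroup α) : (List α →₀ ℤ) →ₗ[ℤ] (List α →₀ ℤ) :=
  (rep x₀ z : Module.End ℤ (List α →₀ ℤ))

/-- The Magnus expansion. -/
noncomputable def expansion (x₀ : α) (z : FreeGroup α) : List α →₀ ℤ :=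
  act x₀ z (Finsupp.single [] 1)

variable (x₀ : α)

@[simp]
theorem act_one (m : List α →₀ ℤ) : act x₀ 1 m = m := by
  simp [act]

@[simp]
theorem act_mul (z z' : FreeGroup α) (m : List α →₀ ℤ) :
    act x₀ (z * z') m = act x₀ z (act x₀ z' m) := by
  simp [act]

@[simp]
theorem act_inv_act (z : FreeGroup α) (m : List α →₀ ℤ) : act x₀ z⁻¹ (act x₀ z m) = m := by
  rw [← act_mul, inv_mul_cancel, act_one]

@[simp]
theorem act_act_inv (z : FreeGroup α) (m : List α →₀ ℤ) : act x₀ z (act x₀ z⁻¹ m) = m := by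
  rw [← act_mul, mul_inv_cancel, act_one]

theorem act_of_base (m : List α →₀ ℤ) : act x₀ (FreeGroup.of x₀) m = m := by
  simp [act, rep]

variable {x₀}

theorem act_of {a : α} (h : a ≠ x₀) (m : List α →₀ ℤ) :
    act x₀ (FreeGroup.of a) m = m + letter a m := by
  simp [act, rep, h, letterUnit]

theorem rep_eq_one_iff {z : FreeGroup α} : rep x₀ z = 1 ↔ ∀ m, act x₀ z m = m := by
  rw [Units.ext_iff, LinearMap.ext_iff]
  rfl

theorem expansion_eq_of_rep_eq_one {z : FreeGroup α} (h : rep x₀ z = 1) :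
    expansion x₀ z = Finsupp.single [] 1 :=
  rep_eq_one_iff.1 h _

/-- To prove a property of all free group elements it suffices to treat generators, provided it is
stable under products and inverses. -/
theorem freeGroup_induction {C : FreeGroup α → Prop} (z : FreeGroup α) (one : C 1)
    (of : ∀ a, C (FreeGroup.of a)) (inv : ∀ z, C z → C z⁻¹)
    (mul : ∀ z z', C z → C z' → C (z * z')) : C z :=
  FreeGroup.induction_on z one of (fun _ h => inv _ h) mul

section Words

/-- Words that contain a given letter. -/
def wordsWith (b : α) : Submodule ℤ (List α →₀ ℤ) := Finsupp.supported ℤ ℤ {w | b ∈ w}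

theorem single_mem_wordsWith {b : α} {w : List α} (h : b ∈ w) (c : ℤ) :
    Finsupp.single w c ∈ wordsWith b :=
  Finsupp.single_mem_supported ℤ c h

theorem apply_eq_zero_of_mem_wordsWith {b : α} {m : List α →₀ ℤ} (hm : m ∈ wordsWith b)
    {w : List α} (h : b ∉ w) : m w = 0 := by
  by_contra h0
  exact h ((Finsupp.mem_supported ℤ m).1 hm (by simpa using h0))

theorem wordsWith_induction {b : α} {p : (List α →₀ ℤ) → Prop} {m : List α →₀ ℤ}
    (hm : m ∈ wordsWith b) (zero : p 0) (add : ∀ m m', p m → p m' → p (m + m'))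
    (single : ∀ w c, b ∈ w → p (Finsupp.single w c)) : p m := by
  rw [← Finsupp.sum_single m]
  refine Finset.sum_induction _ p add zero fun w hw => ?_
  exact single w _ ((Finsupp.mem_supported ℤ m).1 hm hw)

theorem letter_mem_wordsWith (a b : α) {m : List α →₀ ℤ} (hm : m ∈ wordsWith b) :
    letter a m ∈ wordsWith b := by
  refine wordsWith_induction (p := fun m => letter a m ∈ wordsWith b) hm (by simp) (fun m m' h h' => ?_) fun w c hw => ?_
  · rw [map_add]
    exact add_mem h h'
  · by_cases h : a ∈ w
    · simp [letter_single_of_mem h]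
    · rw [letter_single_of_notMem h]
      exact single_mem_wordsWith (by simp [hw]) c

theorem letter_self_mem_wordsWith (b : α) (m : List α →₀ ℤ) : letter b m ∈ wordsWith b := by
  induction m using Finsupp.induction_linear with
  | zero => simp
  | add m m' h h' =>
    rw [map_add]
    exact add_mem h h'
  | single w c =>
    by_cases h : b ∈ w
    · simp [letter_single_of_mem h]
    · rw [letter_single_of_notMem h]
      exact single_mem_wordsWith (by simp) c

theorem letter_eq_zero_of_mem_wordsWith {b : α} {m : List α →₀ ℤ} (hm : m ∈ wordsWith b) :
    letter b m = 0 := by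
  refine wordsWith_induction (p := fun m => letter b m = 0) hm (by simp) (fun m m' h h' => ?_) fun w c hw => ?_
  · rw [map_add, h, h', add_zero]
  · exact letter_single_of_mem hw c

theorem act_mem_wordsWith (z : FreeGroup α) (b : α) {m : List α →₀ ℤ} (hm : m ∈ wordsWith b) :
    act x₀ z m ∈ wordsWith b := by
  induction z using FreeGroup.induction_on generalizing m with
  | C1 => simpa
  | of a =>
    by_cases h : a = x₀
    · subst h
      rwa [act_of_base]
    · rw [act_of h]
      exact add_mem hm (letter_mem_wordsWith a b hm)
  -- Invariance of a submodule does not pass from an operator to its inverse, so the inverse of a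
  -- generator is computed explicitly as `1 - letter a`.
  | inv_of a =>
    by_cases h : a = x₀
    · subst h
      have : act a (FreeGroup.of a)⁻¹ m = m := by
        conv_lhs => rw [← act_of_base a m]
        exact act_inv_act _ _ _
      rw [this]
      exact hm
    · have : act x₀ (FreeGroup.of a)⁻¹ m = m - letter a m := by
        simp [act, rep, h, letterUnit]
      rw [this]
      exact sub_mem hm (letter_mem_wordsWith a b hm)
  | mul z z' h h' =>
    rw [act_mul]
    exact h (h' hm)

variable (x₀) in
/-- The elements that act trivially on words with the letter `b` and modulo such words. -/
def inertia (b : α) : Subgroup (FreeGroup α) where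
  carrier := {z | (∀ m, act x₀ z m - m ∈ wordsWith b) ∧ ∀ m ∈ wordsWith b, act x₀ z m = m}
  one_mem' := by simp
  mul_mem' := by
    rintro z z' ⟨h1, h2⟩ ⟨h1', h2'⟩
    refine ⟨fun m => ?_, fun m hm => ?_⟩
    · rw [act_mul, ← sub_add_sub_cancel _ (act x₀ z' m)]
      exact add_mem (h1 _) (h1' _)
    · rw [act_mul, h2' m hm, h2 m hm]
  inv_mem' := by
    rintro z ⟨h1, h2⟩
    refine ⟨fun m => ?_, fun m hm => ?_⟩
    · have := h1 (act x₀ z⁻¹ m)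
      rw [act_act_inv] at this
      rw [← neg_sub]
      exact neg_mem this
    · conv_lhs => rw [← h2 m hm]
      exact act_inv_act _ _ _

instance (b : α) : (inertia x₀ b).Normal where
  conj_mem := by
    rintro z ⟨h1, h2⟩ g
    refine ⟨fun m => ?_, fun m hm => ?_⟩
    · have : act x₀ (g * z * g⁻¹) m - m =
          act x₀ g (act x₀ z (act x₀ g⁻¹ m) - act x₀ g⁻¹ m) := by
        simp
      rw [this]
      exact act_mem_wordsWith _ _ (h1 _)
    · rw [act_mul, act_mul, h2 _ (act_mem_wordsWith _ _ hm), act_act_inv]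

theorem of_mem_inertia (b : α) : FreeGroup.of b ∈ inertia x₀ b := by
  by_cases h : b = x₀
  · subst h
    exact ⟨fun m => by simp [act_of_base], fun m _ => act_of_base _ m⟩
  · refine ⟨fun m => ?_, fun m hm => ?_⟩
    · rw [act_of h, add_sub_cancel_left]
      exact letter_self_mem_wordsWith b m
    · rw [act_of h, letter_eq_zero_of_mem_wordsWith hm, add_zero]

theorem act_comm_of_mem_inertia {b : α} {u v : FreeGroup α} (hu : u ∈ inertia x₀ b)
    (hv : v ∈ inertia x₀ b) (m : List α →₀ ℤ) :
    act x₀ u (act x₀ v m) = act x₀ v (act x₀ u m) := by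
  -- The displacement of `m` under `v` lies in `wordsWith b`, where `u` is the identity. Both
  -- composites therefore add the two displacements to `m`.
  have h1 : act x₀ u (act x₀ v m) = act x₀ u m + (act x₀ v m - m) := by
    rw [← hu.2 _ (hv.1 m), ← map_add, add_sub_cancel]
  have h2 : act x₀ v (act x₀ u m) = act x₀ v m + (act x₀ u m - m) := by
    rw [← hv.2 _ (hu.1 m), ← map_add, add_sub_cancel]
  rw [h1, h2]
  abel

/-- The Magnus representation kills left-normed commutators with a repeated entry. -/
theorem rep_leftNormed {l : List α} (hl : ¬ l.Nodup) :
    rep x₀ (SimplicialGroup.leftNormed (l.map FreeGroup.of)) = 1 := by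
  refine leftNormed_mem_of_not_nodup (L := (rep x₀).ker) (inertia x₀) of_mem_inertia ?_ hl
  intro b u hu v hv
  rw [MonoidHom.mem_ker, rep_eq_one_iff]
  intro m
  rw [commutatorElement_def, act_mul, act_mul, act_mul, act_comm_of_mem_inertia hu hv]
  simp

/-- Elements of the normal closure of a letter have only words with that letter in their Magnus
expansion. -/
theorem expansion_apply_eq_zero {b : α} {z : FreeGroup α}
    (hz : z ∈ Subgroup.normalClosure {FreeGroup.of b}) {w : List α} (hw : b ∉ w) (h0 : w ≠ []) :
    expansion x₀ z w = 0 := by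
  have hz' : z ∈ inertia x₀ b := by
    have : Subgroup.normalClosure {FreeGroup.of b} ≤ inertia x₀ b := by
      refine Subgroup.normalClosure_le_normal ?_
      rintro _ rfl
      exact of_mem_inertia b
    exact this hz
  have := apply_eq_zero_of_mem_wordsWith (hz'.1 (Finsupp.single [] 1)) hw
  rw [Finsupp.sub_apply, Finsupp.single_eq_of_ne h0, sub_zero] at this
  exact this

end Words

theorem act_apply_nil (z : FreeGroup α) (m : List α →₀ ℤ) : act x₀ z m [] = m [] := by
  induction z using freeGroup_induction generalizing m with
  | one => simp
  | of a =>
    by_cases h : a = x₀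
    · subst h
      rw [act_of_base]
    · rw [act_of h, Finsupp.add_apply, add_eq_left]
      exact apply_eq_zero_of_mem_wordsWith (letter_self_mem_wordsWith a m) (by simp)
  | inv z h => rw [← h, act_act_inv]
  | mul z z' h h' => rw [act_mul, h, h']

end Magnus

/-! ### Naturality of the Magnus expansion under pointed maps of letters. -/

namespace Magnus

section Naturality

variable {α β : Type*} {x₀ : α} {y₀ : β} {φ : α → β}

/-- The map induced by a pointed map of letters: words with a repeated letter or with the base
point are sent to zero. -/
noncomputable def mapWords (y₀ : β) (φ : α → β) : (List α →₀ ℤ) →ₗ[ℤ] (List β →₀ ℤ) :=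
  open Classical in
  Finsupp.linearCombination ℤ fun w =>
    if (w.map φ).Nodup ∧ y₀ ∉ w.map φ then Finsupp.single (w.map φ) 1 else 0

theorem mapWords_single {w : List α} (h1 : (w.map φ).Nodup) (h2 : y₀ ∉ w.map φ) (c : ℤ) :
    mapWords y₀ φ (Finsupp.single w c) = Finsupp.single (w.map φ) c := by
  rw [mapWords, Finsupp.linearCombination_single, if_pos ⟨h1, h2⟩, Finsupp.smul_single, smul_eq_mul,
    mul_one]

theorem mapWords_single_eq_zero {w : List α} (h : (w.map φ).Nodup → y₀ ∈ w.map φ) (c : ℤ) :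
    mapWords y₀ φ (Finsupp.single w c) = 0 := by
  rw [mapWords, Finsupp.linearCombination_single, if_neg (fun h' => h'.2 (h h'.1)), smul_zero]

theorem mapWords_nil (c : ℤ) :
    mapWords y₀ φ (Finsupp.single [] c) = Finsupp.single [] c :=
  mapWords_single (by simp) (by simp) c

theorem mapWords_letter_of_base {a : α} (h : φ a = y₀) (m : List α →₀ ℤ) :
    mapWords y₀ φ (letter a m) = 0 := by
  induction m using Finsupp.induction_linear with
  | zero => simp
  | add m m' h h' => rw [map_add, map_add, h, h', add_zero]
  | single w c =>
    by_cases hw : a ∈ w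
    · rw [letter_single_of_mem hw, map_zero]
    · rw [letter_single_of_notMem hw, mapWords_single_eq_zero]
      simp [h]

theorem mapWords_letter {a : α} (h : φ a ≠ y₀) (m : List α →₀ ℤ) :
    mapWords y₀ φ (letter a m) = letter (φ a) (mapWords y₀ φ m) := by
  classical
  induction m using Finsupp.induction_linear with
  | zero => simp
  | add m m' h h' => rw [map_add, map_add, map_add, map_add, h, h']
  | single w c =>
    by_cases hw : a ∈ w
    · rw [letter_single_of_mem hw, map_zero]
      by_cases h' : (w.map φ).Nodup ∧ y₀ ∉ w.map φ
      · rw [mapWords_single h'.1 h'.2, letter_single_of_mem (List.mem_map_of_mem hw)]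
      · rw [mapWords_single_eq_zero (by tauto), map_zero]
    · rw [letter_single_of_notMem hw]
      by_cases h' : (w.map φ).Nodup ∧ y₀ ∉ w.map φ
      · rw [mapWords_single h'.1 h'.2]
        by_cases hm : φ a ∈ w.map φ
        · rw [letter_single_of_mem hm, mapWords_single_eq_zero]
          intro h''
          rw [List.map_cons, List.nodup_cons] at h''
          exact absurd hm h''.1
        · rw [letter_single_of_notMem hm, mapWords_single, List.map_cons]
          · rw [List.map_cons, List.nodup_cons]
            exact ⟨hm, h'.1⟩
          · rw [List.map_cons, List.mem_cons, not_or]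
            exact ⟨h.symm, h'.2⟩
      · rw [mapWords_single_eq_zero (w := w) (by tauto), map_zero, mapWords_single_eq_zero]
        intro h''
        rw [List.map_cons, List.nodup_cons] at h''
        rw [List.map_cons, List.mem_cons]
        tauto

theorem mapWords_act (hφ : φ x₀ = y₀) (z : FreeGroup α) (m : List α →₀ ℤ) :
    mapWords y₀ φ (act x₀ z m) = act y₀ (FreeGroup.map φ z) (mapWords y₀ φ m) := by
  induction z using freeGroup_induction generalizing m with
  | one => simp
  | of a =>
    rw [FreeGroup.map.of]
    by_cases h : a = x₀
    · subst h
      rw [act_of_base, hφ, act_of_base]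
    · rw [act_of h, map_add]
      by_cases h' : φ a = y₀
      · rw [mapWords_letter_of_base h', h', act_of_base, add_zero]
      · rw [mapWords_letter h', act_of h']
  | inv z h =>
    have := h (act x₀ z⁻¹ m)
    rw [act_act_inv] at this
    rw [this, map_inv, act_inv_act]
  | mul z z' h h' => rw [act_mul, h, h', map_mul, act_mul]

theorem mapWords_expansion (hφ : φ x₀ = y₀) (z : FreeGroup α) :
    mapWords y₀ φ (expansion x₀ z) = expansion y₀ (FreeGroup.map φ z) := by
  rw [expansion, mapWords_act hφ, mapWords_nil, expansion]

end Naturality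

/-! ### What a trivial face says about the words in an expansion. -/

section Holes

variable {α β : Type*} {x₀ : α} {y₀ : β} {φ : α → β}

/-- Serves both kinds of faces: `q` is a second letter for an inner face, and the base point for a
face that kills `p`. -/
theorem map_eq_map_of_notMem {p q : α} (hinj : ∀ x x', φ x = φ x' → x = x' ∨
      (x = p ∨ x = q) ∧ (x' = p ∨ x' = q)) {u w : List α} (hp : p ∉ w) (hq : q ∉ w)
    (h : u.map φ = w.map φ) : u = w := by
  induction w generalizing u with
  | nil => simpa using h
  | cons a w ih =>
    obtain ⟨b, u, rfl, hb, hu⟩ := List.map_eq_cons_iff.1 (h.trans List.map_cons)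
    simp only [List.mem_cons, not_or] at hp hq
    rcases hinj _ _ hb with rfl | ⟨_, rfl | rfl⟩
    · rw [ih hp.2 hq.2 hu]
    · exact absurd rfl hp.1
    · exact absurd rfl hq.1

theorem map_swap_of_notMem [DecidableEq α] {p q : α} {w : List α} (hp : p ∉ w) (hq : q ∉ w) :
    w.map (Equiv.swap p q) = w := by
  conv_rhs => rw [← List.map_id w]
  refine List.map_congr_left fun a ha => Equiv.swap_apply_of_ne_of_ne ?_ ?_
  · rintro rfl
    exact hp ha
  · rintro rfl
    exact hq ha

/-- A word without repetition has at most one entry `p`, so at most one entry can be lifted in a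
second way. -/
theorem map_eq_map_iff [DecidableEq α] {p q : α} (hpq : φ p = φ q)
    (hinj : ∀ x x', φ x = φ x' → x = x' ∨ (x = p ∨ x = q) ∧ (x' = p ∨ x' = q))
    {u w : List α} (hw : w.Nodup) (hq : q ∉ w) :
    u.map φ = w.map φ ↔ u = w ∨ u = w.map (Equiv.swap p q) := by
  constructor
  · intro h
    induction w generalizing u with
    | nil => exact .inl (by simpa using h)
    | cons a w ih =>
      obtain ⟨b, u, rfl, hb, hu⟩ := List.map_eq_cons_iff.1 (h.trans List.map_cons)
      simp only [List.mem_cons, not_or] at hq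
      rw [List.nodup_cons] at hw
      by_cases ha : a = p
      · subst ha
        obtain rfl := map_eq_map_of_notMem hinj hw.1 hq.2 hu
        rw [List.map_cons, map_swap_of_notMem hw.1 hq.2, Equiv.swap_apply_left]
        rcases hinj _ _ hb with rfl | ⟨rfl | rfl, _⟩ <;> simp
      · have hba : b = a := by
          rcases hinj _ _ hb with rfl | ⟨_, rfl | rfl⟩
          · rfl
          · exact absurd rfl ha
          · exact absurd rfl hq.1
        subst hba
        rw [List.map_cons, Equiv.swap_apply_of_ne_of_ne ha (Ne.symm hq.1)]
        rcases ih hw.2 hq.2 hu with rfl | rfl <;> simp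
  · have hs : φ ∘ Equiv.swap p q = φ := by
      ext x
      by_cases hx : x = p
      · subst hx
        simp [hpq]
      · by_cases hx' : x = q
        · subst hx'
          simp [hpq]
        · rw [Function.comp_apply, Equiv.swap_apply_of_ne_of_ne hx hx']
    rintro (rfl | rfl)
    · rfl
    · rw [List.map_map, hs]

theorem mapWords_apply_map {w : List α} (h1 : (w.map φ).Nodup) (h2 : y₀ ∉ w.map φ) (u : List α)
    (c : ℤ) [Decidable (u.map φ = w.map φ)] :
    mapWords y₀ φ (Finsupp.single u c) (w.map φ) = if u.map φ = w.map φ then c else 0 := by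
  split_ifs with h
  · rw [mapWords_single (by rwa [h]) (by rwa [h]), h, Finsupp.single_eq_same]
  · by_cases h' : (u.map φ).Nodup ∧ y₀ ∉ u.map φ
    · rw [mapWords_single h'.1 h'.2, Finsupp.single_eq_of_ne (Ne.symm h)]
    · rw [mapWords_single_eq_zero (by tauto), Finsupp.zero_apply]

/-- If `φ` identifies precisely the letters `p` and `q`, and kills the Magnus expansion of `z`, then
the coefficients of words that differ by exchanging `p` and `q` add up to zero. -/
theorem expansion_apply_add_swap [DecidableEq α] (hφ : φ x₀ = y₀) {p q : α} (hpq : φ p = φ q)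
    (hp0 : p ≠ x₀) (hq0 : q ≠ x₀)
    (hinj : ∀ x x', φ x = φ x' → x = x' ∨ (x = p ∨ x = q) ∧ (x' = p ∨ x' = q))
    {z : FreeGroup α} (hz : expansion y₀ (FreeGroup.map φ z) = Finsupp.single [] 1)
    {w : List α} (hw : w.Nodup) (h0 : x₀ ∉ w) (hp : p ∈ w) (hq : q ∉ w) :
    expansion x₀ z w + expansion x₀ z (w.map (Equiv.swap p q)) = 0 := by
  classical
  have h1 : (w.map φ).Nodup := by
    refine (List.nodup_map_iff_inj_on hw).2 fun a ha b hb hab => ?_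
    rcases hinj _ _ hab with h | ⟨rfl | rfl, rfl | rfl⟩ <;> first | assumption | rfl | contradiction
  have h2 : y₀ ∉ w.map φ := by
    rw [List.mem_map]
    rintro ⟨a, ha, h⟩
    rw [← hφ] at h
    rcases hinj _ _ h with rfl | ⟨_, rfl | rfl⟩ <;> contradiction
  have hne : w ≠ w.map (Equiv.swap p q) := by
    intro h
    have : q ∈ w.map (Equiv.swap p q) := List.mem_map.2 ⟨p, hp, Equiv.swap_apply_left _ _⟩
    exact hq (h ▸ this)
  -- The two words are the only preimages of `w.map φ`, so its coefficient in the image of `m` is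
  -- the sum of theirs.
  have key (m : List α →₀ ℤ) :
      mapWords y₀ φ m (w.map φ) = m w + m (w.map (Equiv.swap p q)) := by
    induction m using Finsupp.induction_linear with
    | zero => simp
    | add m m' h h' =>
      rw [map_add, Finsupp.add_apply, h, h', Finsupp.add_apply, Finsupp.add_apply]
      ring
    | single u c =>
      rw [mapWords_apply_map h1 h2, Finsupp.single_apply, Finsupp.single_apply]
      by_cases hu : u = w
      · subst hu
        simp [hne]
      · by_cases hu' : u = w.map (Equiv.swap p q)
        · rw [if_pos ((map_eq_map_iff hpq hinj hw hq).2 (.inr hu')), if_neg hu, if_pos hu', zero_add]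
        · rw [if_neg, if_neg hu, if_neg hu', zero_add]
          rw [map_eq_map_iff hpq hinj hw hq]
          tauto
  rw [← key, mapWords_expansion hφ, hz, Finsupp.single_eq_of_ne]
  rintro h
  rw [List.map_eq_nil_iff] at h
  subst h
  simp at hp

/-- If `φ` only collapses the letter `p` to the base point, and kills the Magnus expansion of `z`,
then this expansion has no nonempty words without `p`. -/
theorem expansion_apply_eq_zero_of_kill (hφ : φ x₀ = y₀) {p : α}
    (hinj : ∀ x x', φ x = φ x' → x = x' ∨ (x = p ∨ x = x₀) ∧ (x' = p ∨ x' = x₀))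
    {z : FreeGroup α} (hz : expansion y₀ (FreeGroup.map φ z) = Finsupp.single [] 1)
    {w : List α} (hw : w.Nodup) (h0 : x₀ ∉ w) (hp : p ∉ w) (hne : w ≠ []) :
    expansion x₀ z w = 0 := by
  classical
  have h1 : (w.map φ).Nodup := by
    refine (List.nodup_map_iff_inj_on hw).2 fun a ha b hb hab => ?_
    rcases hinj _ _ hab with h | ⟨rfl | rfl, rfl | rfl⟩ <;> first | assumption | rfl | contradiction
  have h2 : y₀ ∉ w.map φ := by
    rw [List.mem_map]
    rintro ⟨a, ha, h⟩
    rw [← hφ] at h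
    rcases hinj _ _ h with rfl | ⟨rfl | rfl, _⟩ <;> contradiction
  have key (m : List α →₀ ℤ) : mapWords y₀ φ m (w.map φ) = m w := by
    induction m using Finsupp.induction_linear with
    | zero => simp
    | add m m' h h' => rw [map_add, Finsupp.add_apply, h, h', Finsupp.add_apply]
    | single u c =>
      rw [mapWords_apply_map h1 h2, Finsupp.single_apply]
      congr 1
      exact propext ⟨fun h => map_eq_map_of_notMem hinj hp h0 h, fun h => h ▸ rfl⟩
  rw [← key, mapWords_expansion hφ, hz, Finsupp.single_eq_of_ne]
  simpa using hne

/-- A map of letters kills a Magnus expansion if it kills all nonempty words that occur in it. -/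
theorem expansion_map_eq_of_kill (hφ : φ x₀ = y₀) {z : FreeGroup α}
    (h : ∀ w, w ≠ [] → w.Nodup → x₀ ∉ w → y₀ ∉ w.map φ → expansion x₀ z w = 0) :
    expansion y₀ (FreeGroup.map φ z) = Finsupp.single [] 1 := by
  have hnil : expansion x₀ z [] = 1 := by
    rw [expansion, act_apply_nil, Finsupp.single_eq_same]
  rw [← mapWords_expansion hφ]
  generalize expansion x₀ z = m at h hnil
  have key : ∀ w ∈ m.support, w ≠ [] → mapWords y₀ φ (Finsupp.single w (m w)) = 0 := by
    intro w hw hne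
    rw [Finsupp.mem_support_iff] at hw
    refine mapWords_single_eq_zero (fun h1 => ?_) _
    by_contra h2
    refine hw (h w hne h1.of_map ?_ h2)
    exact fun h3 => h2 (hφ ▸ List.mem_map_of_mem h3)
  conv_lhs => rw [← Finsupp.sum_single m]
  rw [Finsupp.sum, map_sum, Finset.sum_eq_single []]
  · rw [hnil, mapWords_nil]
  · exact key
  · intro h'
    rw [Finsupp.notMem_support_iff] at h'
    rw [h', Finsupp.single_zero, map_zero]

end Holes

/-! ### Injectivity of the expansion on the reduced free group. -/

section Injectivity

variable {α K : Type*} [Group K] {x₀ : α} {q : FreeGroup α →* K}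

open Classical in
/-- The iterated commutator attached to a word that ends in `a` (and `1` for other words). -/
noncomputable def bracket (q : FreeGroup α →* K) (a : α) (w : List α) : K :=
  match w with
  | [] => 1
  | [x] => if x = a then q (FreeGroup.of a) else 1
  | b :: c :: l => ⁅q (FreeGroup.of b), bracket q a (c :: l)⁆

theorem bracket_cons {a b : α} {w : List α} (hw : w ≠ []) :
    bracket q a (b :: w) = ⁅q (FreeGroup.of b), bracket q a w⁆ := by
  cases w with
  | nil => exact absurd rfl hw
  | cons c l => rw [bracket]

theorem bracket_mem_normalClosure_end (a : α) (w : List α) :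
    bracket q a w ∈ Subgroup.normalClosure {q (FreeGroup.of a)} := by
  induction w with
  | nil => exact one_mem _
  | cons b w ih =>
    rcases eq_or_ne w [] with rfl | hw
    · rw [bracket]
      split_ifs
      · exact Subgroup.subset_normalClosure (Set.mem_singleton _)
      · exact one_mem _
    · rw [bracket_cons hw]
      exact commutatorElement_mem_right ih _

/-- Counterpart of the vanishing of words with a repeated letter: as the normal closure of the image
of `b` is commutative, conjugation by that image fixes the brackets of words that contain `b`. -/
theorem bracket_mem_normalClosure {a b : α} {w : List α} (hb : b ∈ w) :
    bracket q a w ∈ Subgroup.normalClosure {q (FreeGroup.of b)} := by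
  induction w with
  | nil => simp at hb
  | cons c w ih =>
    rcases eq_or_ne w [] with rfl | hw
    · obtain rfl : b = c := by simpa using hb
      rw [bracket]
      split_ifs with h
      · subst h
        exact Subgroup.subset_normalClosure (Set.mem_singleton _)
      · exact one_mem _
    · rw [bracket_cons hw]
      rcases List.mem_cons.1 hb with rfl | h
      · exact commutatorElement_mem_left (Subgroup.subset_normalClosure (Set.mem_singleton _)) _
      · exact commutatorElement_mem_right (ih h) _

/-- The crossed homomorphism that a letter `a` defines, given that the normal closure of its image
is commutative. -/
theorem exists_crossedHom (hbase : q (FreeGroup.of x₀) = 1)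
    (hcomm : ∀ b, ∀ u ∈ Subgroup.normalClosure {q (FreeGroup.of b)},
      ∀ v ∈ Subgroup.normalClosure {q (FreeGroup.of b)}, Commute u v) {a : α} (ha : a ≠ x₀) :
    ∃ c : FreeGroup α → K, (∀ z, c z ∈ Subgroup.normalClosure {q (FreeGroup.of a)}) ∧
      (∀ z z', c (z * z') = c z * (q z * c z' * (q z)⁻¹)) ∧
      c (FreeGroup.of a) = q (FreeGroup.of a) ∧ (∀ b, b ≠ a → c (FreeGroup.of b) = 1) ∧
      ∀ z, expansion x₀ z = Finsupp.single [] 1 → c z = 1 := by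
  let N : Subgroup K := Subgroup.normalClosure {q (FreeGroup.of a)}
  let _ : CommGroup N :=
    { (inferInstance : Group N) with mul_comm := fun u v => Subtype.ext (hcomm a u u.2 v v.2) }
  let br (w : List α) : Additive N := .ofMul ⟨bracket q a w, bracket_mem_normalClosure_end a w⟩
  -- `Λ` turns prepending a letter into taking a commutator, so on combinations of nonempty words it
  -- carries the Magnus action to conjugation. The crossed homomorphism is `Λ` applied to the
  -- expansion.
  let Λ : (List α →₀ ℤ) →ₗ[ℤ] Additive N := Finsupp.linearCombination ℤ br
  have hΛ (w : List α) (k : ℤ) : Λ (Finsupp.single w k) = k • br w :=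
    Finsupp.linearCombination_single ..
  let conj (g : FreeGroup α) : Additive N →+ Additive N :=
    MonoidHom.toAdditive (MulAut.conjNormal (q g) : N ≃* N).toMonoidHom
  have conj_coe (g : FreeGroup α) (x : Additive N) :
      ((conj g x).toMul : K) = q g * (x.toMul : K) * (q g)⁻¹ :=
    MulAut.conjNormal_apply (q g) x.toMul
  have conj_mul (g h : FreeGroup α) (x : Additive N) : conj (g * h) x = conj g (conj h x) := by
    apply Additive.toMul.injective
    apply Subtype.ext
    rw [conj_coe, conj_coe, conj_coe, map_mul]
    group
  have conj_one (x : Additive N) : conj 1 x = x := by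
    apply Additive.toMul.injective
    apply Subtype.ext
    rw [conj_coe, map_one]
    group
  have conj_letter (b : α) (w : List α) (hw : w ≠ []) (hbw : b ∉ w) :
      br (b :: w) = conj (FreeGroup.of b) (br w) - br w := by
    apply Additive.toMul.injective
    apply Subtype.ext
    rw [toMul_sub, Subgroup.coe_div, conj_coe, div_eq_mul_inv]
    change bracket q a (b :: w) = q (FreeGroup.of b) * bracket q a w * (q (FreeGroup.of b))⁻¹ *
      (bracket q a w)⁻¹
    rw [bracket_cons hw, commutatorElement_def]
  have conj_mem (b : α) (w : List α) (hbw : b ∈ w) : conj (FreeGroup.of b) (br w) = br w := by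
    apply Additive.toMul.injective
    apply Subtype.ext
    rw [conj_coe]
    change q (FreeGroup.of b) * bracket q a w * (q (FreeGroup.of b))⁻¹ = bracket q a w
    rw [hcomm b _ (Subgroup.subset_normalClosure (Set.mem_singleton _)) _ (bracket_mem_normalClosure hbw),
      mul_inv_cancel_right]
  -- equivariance on generators
  have equiv_letter (b : α) (hb : b ≠ x₀) (m : List α →₀ ℤ) (hm : m [] = 0) :
      Λ (m + letter b m) = conj (FreeGroup.of b) (Λ m) := by
    -- The empty word must be removed: `br [a]` is the image of `a`, whereas equivariance at the
    -- empty word would force it to be trivial. Subtracting its coefficient makes the claim linear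
    -- in `m`.
    have key (m : List α →₀ ℤ) :
        Λ ((m - Finsupp.single [] (m [])) + letter b (m - Finsupp.single [] (m []))) =
          conj (FreeGroup.of b) (Λ (m - Finsupp.single [] (m []))) := by
      induction m using Finsupp.induction_linear with
      | zero => simp
      | add m m' h h' =>
        have e : m + m' - Finsupp.single [] ((m + m') []) =
            (m - Finsupp.single [] (m [])) + (m' - Finsupp.single [] (m' [])) := by
          rw [Finsupp.add_apply, Finsupp.single_add]
          abel
        rw [e]
        generalize m - Finsupp.single [] (m []) = n at h ⊢
        generalize m' - Finsupp.single [] (m' []) = n' at h' ⊢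
        rw [map_add Λ n n', map_add (conj _), ← h, ← h', ← map_add, map_add (letter b)]
        congr 1
        abel
      | single w k =>
        rcases eq_or_ne w [] with rfl | hw
        · simp
        · rw [Finsupp.single_eq_of_ne (Ne.symm hw), Finsupp.single_zero, sub_zero, hΛ]
          by_cases hbw : b ∈ w
          · rw [letter_single_of_mem hbw, add_zero, hΛ, map_zsmul, conj_mem b w hbw]
          · rw [letter_single_of_notMem hbw, map_add, hΛ, hΛ, map_zsmul, conj_letter b w hw hbw,
              ← smul_add]
            congr 1
            exact add_sub_cancel (br w) _
    simpa [hm] using key m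
  have equiv (g : FreeGroup α) : ∀ m : List α →₀ ℤ, m [] = 0 → Λ (act x₀ g m) = conj g (Λ m) := by
    induction g using freeGroup_induction with
    | one => intro m _; rw [act_one, conj_one]
    | of b =>
      intro m hm
      by_cases hb : b = x₀
      · subst hb
        rw [act_of_base]
        apply Additive.toMul.injective
        apply Subtype.ext
        rw [conj_coe, hbase]
        group
      · rw [act_of hb, equiv_letter b hb m hm]
    | inv g h =>
      intro m hm
      have := h (act x₀ g⁻¹ m) (by rw [act_apply_nil, hm])
      rw [act_act_inv] at this
      rw [this, ← conj_mul, inv_mul_cancel, conj_one]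
    | mul g h hg hh =>
      intro m hm
      rw [act_mul, hg _ (by rw [act_apply_nil, hm]), hh m hm, conj_mul]
  have hnil : br [] = 0 := rfl
  have hof (b : α) (hb : b ≠ x₀) : Λ (expansion x₀ (FreeGroup.of b)) = br [b] := by
    rw [expansion, act_of hb, letter_single_of_notMem (by simp), map_add, hΛ, hΛ, hnil]
    simp
  refine ⟨fun z => ((Λ (expansion x₀ z)).toMul : K), fun z => (Λ (expansion x₀ z)).toMul.2,
    fun z z' => ?_, ?_, fun b hb => ?_, fun z hz => ?_⟩
  · have e : expansion x₀ (z * z') =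
        expansion x₀ z + act x₀ z (expansion x₀ z' - Finsupp.single [] 1) := by
      rw [map_sub, expansion, act_mul]
      exact (add_sub_cancel _ _).symm
    have hn : (expansion x₀ z' - Finsupp.single [] 1 : List α →₀ ℤ) [] = 0 := by
      rw [Finsupp.sub_apply, expansion, act_apply_nil, sub_self]
    have e2 : Λ (expansion x₀ (z * z')) = Λ (expansion x₀ z) + conj z (Λ (expansion x₀ z')) := by
      rw [e, map_add, equiv _ _ hn, map_sub, hΛ, hnil, smul_zero, sub_zero]
    dsimp only
    rw [e2, toMul_add, Subgroup.coe_mul, conj_coe]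
  · change ((Λ (expansion x₀ (FreeGroup.of a))).toMul : K) = _
    rw [hof a ha]
    change bracket q a [a] = _
    rw [bracket, if_pos rfl]
  · change ((Λ (expansion x₀ (FreeGroup.of b))).toMul : K) = _
    by_cases hb0 : b = x₀
    · subst hb0
      rw [expansion, act_of_base, hΛ, hnil, smul_zero]
      rfl
    · rw [hof b hb0]
      change bracket q a [b] = _
      rw [bracket, if_neg hb]
  · change ((Λ (expansion x₀ z)).toMul : K) = _
    rw [hz, hΛ, hnil, smul_zero]
    rfl

/-- With the crossed homomorphism `c`, the map `z ↦ (c z)⁻¹ * q z` is a homomorphism because the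
values of `c` commute. On generators it agrees with `q` after sending `a` to the base point, and `c
z = 1` when the expansion of `z` is trivial. -/
theorem map_update_eq_of_expansion_eq [DecidableEq α] (hbase : q (FreeGroup.of x₀) = 1)
    (hcomm : ∀ b, ∀ u ∈ Subgroup.normalClosure {q (FreeGroup.of b)},
      ∀ v ∈ Subgroup.normalClosure {q (FreeGroup.of b)}, Commute u v) (a : α)
    {z : FreeGroup α} (hz : expansion x₀ z = Finsupp.single [] 1) :
    q (FreeGroup.map (Function.update id a x₀) z) = q z := by
  by_cases ha : a = x₀
  · subst ha
    have : Function.update id a a = (id : α → α) := Function.update_eq_self a id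
    rw [this, FreeGroup.map.id]
  obtain ⟨c, hc, hmul, hca, hcb, hc1⟩ := exists_crossedHom hbase hcomm ha
  let r : FreeGroup α →* K := MonoidHom.mk' (fun z => (c z)⁻¹ * q z) fun z z' => by
    have h1 : (c z)⁻¹ * (q z * (c z')⁻¹ * (q z)⁻¹) = (q z * (c z')⁻¹ * (q z)⁻¹) * (c z)⁻¹ :=
      hcomm a _ (inv_mem (hc z)) _
        (Subgroup.normalClosure_normal.conj_mem _ (inv_mem (hc z')) (q z))
    calc (c (z * z'))⁻¹ * q (z * z')
        = (q z * (c z')⁻¹ * (q z)⁻¹) * (c z)⁻¹ * (q z * q z') := by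
          rw [hmul, map_mul]
          group
      _ = (c z)⁻¹ * q z * ((c z')⁻¹ * q z') := by
          rw [← h1]
          group
  have hr : q.comp (FreeGroup.map (Function.update id a x₀)) = r := by
    ext b
    change q (FreeGroup.map _ (FreeGroup.of b)) = (c (FreeGroup.of b))⁻¹ * q (FreeGroup.of b)
    rw [FreeGroup.map.of]
    by_cases hb : b = a
    · subst hb
      rw [Function.update_self, hbase, hca, inv_mul_cancel]
    · rw [Function.update_of_ne hb, hcb b hb, inv_one, one_mul, id]
  have := DFunLike.congr_fun hr z
  rw [MonoidHom.comp_apply] at this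
  rw [this]
  change (c z)⁻¹ * q z = q z
  rw [hc1 z hz, inv_one, one_mul]

/-- Milnor's theorem: the Magnus expansion is injective on the reduced free group. -/
theorem map_eq_one_of_expansion_eq [Finite α] (hbase : q (FreeGroup.of x₀) = 1)
    (hcomm : ∀ b, ∀ u ∈ Subgroup.normalClosure {q (FreeGroup.of b)},
      ∀ v ∈ Subgroup.normalClosure {q (FreeGroup.of b)}, Commute u v)
    {z : FreeGroup α} (hz : expansion x₀ z = Finsupp.single [] 1) : q z = 1 := by
  classical
  have := Fintype.ofFinite α
  -- Letters are sent to the base point one at a time. The expansion stays trivial and the image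
  -- under `q` does not change; when no letters are left, this image is 1.
  have key (s : Finset α) :
      expansion x₀ (FreeGroup.map (fun b => if b ∈ s then x₀ else b) z) = Finsupp.single [] 1 ∧
      q (FreeGroup.map (fun b => if b ∈ s then x₀ else b) z) = q z := by
    induction s using Finset.induction_on with
    | empty =>
      have : (fun b : α => if b ∈ (∅ : Finset α) then x₀ else b) = id := by
        ext b
        simp
      rw [this, FreeGroup.map.id]
      exact ⟨hz, rfl⟩
    | insert a s _ ih =>
      have : (fun b : α => if b ∈ insert a s then x₀ else b) =
          Function.update id a x₀ ∘ fun b => if b ∈ s then x₀ else b := by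
        ext b
        by_cases hs : b ∈ s
        · simp [hs, Function.update_apply]
        · by_cases hb : b = a
          · subst hb
            simp [hs]
          · simp [hs, hb]
      rw [this, ← FreeGroup.map.comp]
      refine ⟨?_, (map_update_eq_of_expansion_eq hbase hcomm a ih.1).trans ih.2⟩
      rw [← mapWords_expansion (x₀ := x₀), ih.1, mapWords_nil]
      simp [Function.update_apply]
  rw [← (key Finset.univ).2]
  have : q.comp (FreeGroup.map fun b : α => if b ∈ Finset.univ then x₀ else b) = 1 := by
    ext b
    simp [hbase]
  exact DFunLike.congr_fun this z

end Injectivity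

end Magnus

/-! ### Simplicial identities in a simplicial group. -/

namespace SimplicialGroup

section Identities

variable (G : SimplicialGroup.{u})

/-- Faces as group homomorphisms, indexed by natural numbers. -/
def d (n i : ℕ) : G _⦋n + 1⦌ →* G _⦋n⦌ := (G.δ (Fin.ofNat (n + 2) i)).hom

/-- Degeneracies as group homomorphisms, indexed by natural numbers. -/
def s (n i : ℕ) : G _⦋n⦌ →* G _⦋n + 1⦌ := (G.σ (Fin.ofNat (n + 1) i)).hom

/-- Indices out of range wrap around, hence the explicit bounds in the identities that follow. -/
theorem ofNat_eq_mk {n i : ℕ} (h : i < n + 1) : Fin.ofNat (n + 1) i = ⟨i, h⟩ :=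
  Fin.ext (Nat.mod_eq_of_lt h)

variable {G}

theorem δ_apply {n : ℕ} (i : Fin (n + 2)) (x : G _⦋n + 1⦌) : (G.δ i).hom x = G.d n i x := by
  rw [d, ofNat_eq_mk i.2]

theorem d_apply {n i : ℕ} (h : i < n + 2) (x : G _⦋n + 1⦌) : G.d n i x = (G.δ ⟨i, h⟩).hom x := by
  rw [d, ofNat_eq_mk h]

theorem s_apply {n i : ℕ} (h : i < n + 1) (x : G _⦋n⦌) : G.s n i x = (G.σ ⟨i, h⟩).hom x := by
  rw [s, ofNat_eq_mk h]

theorem d_d {n i j : ℕ} (hij : i ≤ j) (hj : j ≤ n + 1) (x : G _⦋n + 1 + 1⦌) :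
    G.d n i (G.d (n + 1) (j + 1) x) = G.d n j (G.d (n + 1) i x) := by
  rw [d_apply (by omega), d_apply (i := j + 1) (by omega), d_apply (by omega),
    d_apply (n := n + 1) (i := i) (by omega)]
  exact ConcreteCategory.congr_hom
    (G.δ_comp_δ (i := ⟨i, by omega⟩) (j := ⟨j, by omega⟩) (by simpa using hij)) x

theorem d_s_of_le {n i j : ℕ} (hij : i ≤ j) (hj : j ≤ n) (x : G _⦋n + 1⦌) :
    G.d (n + 1) i (G.s (n + 1) (j + 1) x) = G.s n j (G.d n i x) := by
  rw [d_apply (by omega), s_apply (by omega), s_apply (by omega), d_apply (by omega)]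
  exact ConcreteCategory.congr_hom
    (G.δ_comp_σ_of_le (i := ⟨i, by omega⟩) (j := ⟨j, by omega⟩) (by simpa using hij)) x

theorem d_s_self {n i : ℕ} (hi : i ≤ n) (x : G _⦋n⦌) : G.d n i (G.s n i x) = x := by
  rw [d_apply (by omega), s_apply (by omega)]
  exact ConcreteCategory.congr_hom (G.δ_comp_σ_self (i := ⟨i, by omega⟩)) x

theorem d_s_succ {n i : ℕ} (hi : i ≤ n) (x : G _⦋n⦌) : G.d n (i + 1) (G.s n i x) = x := by
  rw [d_apply (by omega), s_apply (by omega)]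
  exact ConcreteCategory.congr_hom (G.δ_comp_σ_succ (i := ⟨i, by omega⟩)) x

theorem d_s_of_gt {n i j : ℕ} (hij : j < i) (hi : i ≤ n + 1) (x : G _⦋n + 1⦌) :
    G.d (n + 1) (i + 1) (G.s (n + 1) j x) = G.s n j (G.d n i x) := by
  rw [d_apply (by omega), s_apply (by omega), s_apply (by omega), d_apply (by omega)]
  exact ConcreteCategory.congr_hom
    (G.δ_comp_σ_of_gt (i := ⟨i, by omega⟩) (j := ⟨j, by omega⟩) (by simpa using hij)) x

theorem app_d {G' : SimplicialGroup.{u}} (f : G ⟶ G') (n i : ℕ) (x : G _⦋n + 1⦌) :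
    (f.app (op ⦋n⦌)).hom (G.d n i x) = G'.d n i ((f.app (op ⦋n + 1⦌)).hom x) :=
  ConcreteCategory.congr_hom (SimplicialObject.δ_naturality f (Fin.ofNat (n + 2) i)) x

theorem mem_moore_iff {n : ℕ} {x : G _⦋n + 1⦌} :
    x ∈ G.moore n ↔ ∀ i, i ≠ 0 → i ≤ n + 1 → G.d n i x = 1 := by
  simp only [moore, Subgroup.mem_iInf, MonoidHom.mem_ker]
  constructor
  · intro h i h0 hi
    rw [d_apply (by omega)]
    exact h ⟨i, by omega⟩ (by simpa [Fin.ext_iff] using h0)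
  · intro h i hi
    rw [δ_apply]
    exact h i (fun h0 => hi (Fin.ext h0)) (by omega)

theorem mem_boundaries_iff {n : ℕ} {x : G _⦋n⦌} :
    x ∈ G.boundaries n ↔ ∃ z : G _⦋n + 1⦌, (∀ i, i ≠ 0 → i ≤ n + 1 → G.d n i z = 1) ∧
      G.d n 0 z = x := by
  simp only [boundaries, Subgroup.mem_map, mem_moore_iff]
  rfl

end Identities

/-! ### Moore's horn filling, inside a normal simplicial subgroup. -/

section Filling

variable {G : SimplicialGroup.{u}} (N : G.NormalSub)

theorem NormalSub.d_mem {n : ℕ} (i : ℕ) {x : G _⦋n + 1⦌} (hx : x ∈ N.carrier (op ⦋n + 1⦌)) :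
    G.d n i x ∈ N.carrier (op ⦋n⦌) :=
  N.map_mem _ x hx

theorem NormalSub.s_mem {n : ℕ} (i : ℕ) {x : G _⦋n⦌} (hx : x ∈ N.carrier (op ⦋n⦌)) :
    G.s n i x ∈ N.carrier (op ⦋n + 1⦌) :=
  N.map_mem _ x hx

/-- Horns in a normal simplicial subgroup can be filled, in dimensions at least two. -/
theorem NormalSub.exists_filler {n k : ℕ} (hk : k ≤ n + 2) (x : ℕ → G _⦋n + 1⦌)
    (hx : ∀ i, i ≠ k → i ≤ n + 2 → x i ∈ N.carrier (op ⦋n + 1⦌))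
    (hc : ∀ i j, i ≤ j → j ≤ n + 1 → i ≠ k → j + 1 ≠ k → G.d n i (x (j + 1)) = G.d n j (x i)) :
    ∃ v ∈ N.carrier (op ⦋n + 1 + 1⦌), ∀ i, i ≠ k → i ≤ n + 2 → G.d (n + 1) i v = x i := by
  -- Faces below `k` are corrected in increasing order: multiplying by `s_t` of the error repairs
  -- `d_t`, and by compatibility the error has trivial faces where the earlier faces are already
  -- right.
  have lower (t : ℕ) (ht : t ≤ k) :
      ∃ v ∈ N.carrier (op ⦋n + 1 + 1⦌), ∀ i, i < t → G.d (n + 1) i v = x i := by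
    induction t with
    | zero => exact ⟨1, one_mem _, fun i hi => absurd hi (by omega)⟩
    | succ t ih =>
      obtain ⟨v, hv, hvx⟩ := ih (by omega)
      refine ⟨v * G.s (n + 1) t ((G.d (n + 1) t v)⁻¹ * x t), mul_mem hv (N.s_mem t (mul_mem
        (inv_mem (N.d_mem t hv)) (hx t (by omega) (by omega)))), fun l hl => ?_⟩
      rw [map_mul]
      rcases Nat.lt_succ_iff_lt_or_eq.1 hl with hl | rfl
      · obtain ⟨t, rfl⟩ := Nat.exists_eq_add_one_of_ne_zero (show t ≠ 0 by omega)
        rw [hvx l hl, d_s_of_le (by omega) (by omega), map_mul, map_inv, d_d (by omega) (by omega),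
          hvx l hl, hc l t (by omega) (by omega) (by omega) (by omega), inv_mul_cancel, map_one,
          mul_one]
      · rw [d_s_self (by omega), mul_inv_cancel_left]
  -- Faces above `k` are corrected in decreasing order. Here `s_t` repairs `d_{t+1}`, with `t + 1 =
  -- n + 2 - r`.
  have upper (r : ℕ) (hr : r + k ≤ n + 2) : ∃ v ∈ N.carrier (op ⦋n + 1 + 1⦌),
      (∀ i, i < k → G.d (n + 1) i v = x i) ∧
      ∀ i, n + 2 - r < i → i ≤ n + 2 → G.d (n + 1) i v = x i := by
    induction r with
    | zero =>
      obtain ⟨v, hv, hvx⟩ := lower k le_rfl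
      exact ⟨v, hv, hvx, fun i hi hi' => absurd hi (by omega)⟩
    | succ r ih =>
      obtain ⟨v, hv, hv1, hv2⟩ := ih (by omega)
      obtain ⟨t, ht⟩ : ∃ t, n + 2 = r + 1 + t := ⟨n + 2 - (r + 1), by omega⟩
      refine ⟨v * G.s (n + 1) t ((G.d (n + 1) (t + 1) v)⁻¹ * x (t + 1)), mul_mem hv (N.s_mem t
        (mul_mem (inv_mem (N.d_mem _ hv)) (hx (t + 1) (by omega) (by omega)))), fun l hl => ?_,
        fun l hl hl' => ?_⟩
      · rw [map_mul]
        obtain ⟨t, rfl⟩ := Nat.exists_eq_add_one_of_ne_zero (show t ≠ 0 by omega)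
        rw [hv1 l hl, d_s_of_le (by omega) (by omega), map_mul, map_inv,
          d_d (by omega) (by omega), hv1 l hl, hc l (t + 1) (by omega) (by omega) (by omega)
          (by omega), inv_mul_cancel, map_one, mul_one]
      · rw [map_mul]
        by_cases h : l = t + 1
        · subst h
          rw [d_s_succ (by omega), mul_inv_cancel_left]
        · obtain ⟨l, rfl⟩ := Nat.exists_eq_add_one_of_ne_zero (show l ≠ 0 by omega)
          rw [hv2 _ (by omega) hl', d_s_of_gt (by omega) (by omega), map_mul,
            map_inv, ← d_d (j := l) (by omega) (by omega), hv2 (l + 1) (by omega) (by omega),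
            hc (t + 1) l (by omega) (by omega) (by omega) (by omega), inv_mul_cancel, map_one,
            mul_one]
  obtain ⟨v, hv, hv1, hv2⟩ := upper (n + 2 - k) (by omega)
  refine ⟨v, hv, fun i hi hi' => ?_⟩
  rcases Nat.lt_or_gt_of_ne hi with h | h
  · exact hv1 i h
  · exact hv2 i (by omega) hi'

/-- One-dimensional horns in a normal simplicial subgroup can be filled. -/
theorem NormalSub.exists_filler_zero {k : ℕ} (hk : k ≤ 1) (x : ℕ → G _⦋0⦌)
    (hx : ∀ i, i ≠ k → i ≤ 1 → x i ∈ N.carrier (op ⦋0⦌)) :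
    ∃ v ∈ N.carrier (op ⦋0 + 1⦌), ∀ i, i ≠ k → i ≤ 1 → G.d 0 i v = x i := by
  refine ⟨G.s 0 0 (x (1 - k)), N.s_mem 0 (hx _ (by omega) (by omega)), fun i hi hi' => ?_⟩
  obtain rfl : i = 1 - k := by omega
  interval_cases k
  · exact d_s_succ le_rfl _
  · exact d_s_self le_rfl _

/-- If all faces of `z` but the `k`-th lie in `N`, then they are the faces of an element of `N`. -/
theorem NormalSub.exists_filler_of_faces {n k : ℕ} (hk : k ≤ n + 1) (z : G _⦋n + 1⦌)
    (hz : ∀ i, i ≠ k → i ≤ n + 1 → G.d n i z ∈ N.carrier (op ⦋n⦌)) :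
    ∃ v ∈ N.carrier (op ⦋n + 1⦌), ∀ i, i ≠ k → i ≤ n + 1 → G.d n i v = G.d n i z := by
  cases n with
  | zero => exact N.exists_filler_zero hk (fun i => G.d 0 i z) hz
  | succ n =>
    exact N.exists_filler hk (fun i => G.d (n + 1) i z) hz fun i j hij hj _ _ => d_d hij hj z

variable (G) in
/-- The simplicial group `G` as a normal simplicial subgroup of itself. -/
def topNormalSub : G.NormalSub where
  carrier _ := ⊤
  normal _ := inferInstance
  map_mem _ _ _ := Subgroup.mem_top _

/-- Moore's theorem: simplicial groups are Kan complexes. -/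
theorem kanComplex (G : SimplicialGroup.{u}) : SSet.KanComplex G.toSSet := by
  rw [SSet.KanComplex.iff]
  intro n k f hf
  classical
  let x : ℕ → G _⦋n⦌ := fun j =>
    if h : ∃ hj : j < n + 2, (⟨j, hj⟩ : Fin (n + 2)) ≠ k then
      SSet.yonedaEquiv (f ⟨j, h.1⟩ h.2) else 1
  have hx (j : Fin (n + 2)) (hj : j ≠ k) : x j = SSet.yonedaEquiv (f j hj) :=
    dif_pos ⟨j.2, hj⟩
  obtain ⟨v, -, hv⟩ : ∃ v ∈ (topNormalSub G).carrier (op ⦋n + 1⦌), ∀ i, i ≠ (k : ℕ) → i ≤ n + 1 →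
      G.d n i v = x i := by
    cases n with
    | zero => exact (topNormalSub G).exists_filler_zero (by omega) x fun _ _ _ => Subgroup.mem_top _
    | succ n =>
      refine (topNormalSub G).exists_filler (by omega) x (fun _ _ _ => Subgroup.mem_top _) ?_
      intro i j hij hj hik hjk
      have := (SSet.horn.isCompatible_iff f).1 hf ⟨i, by omega⟩ ⟨j + 1, by omega⟩
        (fun h => hik (by rw [← h])) (fun h => hjk (by rw [← h])) (by simp; omega)
      have h2 := congrArg SSet.yonedaEquiv this
      rw [SSet.stdSimplex.yonedaEquiv_δ_comp, SSet.stdSimplex.yonedaEquiv_δ_comp, ← hx, ← hx] at h2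
      rw [d_apply (by omega), d_apply (by omega)]
      exact h2.symm
  refine ⟨SSet.yonedaEquiv.symm v, fun j hj => ?_⟩
  apply SSet.yonedaEquiv.injective
  rw [← hx, ← hv j (by simpa [Fin.ext_iff] using hj) (by omega), ← δ_apply,
    SSet.stdSimplex.yonedaEquiv_δ_comp, Equiv.apply_symm_apply]
  rfl

end Filling

/-! ### Minimality, boundaries and quotients. -/

section Minimal

/-- If all faces of a simplex but one are trivial, then so is the remaining one. -/
def FacesTrivial (G : SimplicialGroup.{u}) : Prop :=
  ∀ (n k : ℕ) (z : G _⦋n + 1⦌), k ≤ n + 1 → (∀ i, i ≠ k → i ≤ n + 1 → G.d n i z = 1) →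
    G.d n k z = 1

variable {G : SimplicialGroup.{u}}

theorem FacesTrivial.isMinimal (h : G.FacesTrivial) : G.IsMinimal where
  kan := kanComplex G
  face_eq n k x y hxy := by
    have := h n k ((x : G _⦋n + 1⦌) * (y : G _⦋n + 1⦌)⁻¹) (by omega) fun i hi hi' => by
      rw [map_mul, map_inv, mul_inv_eq_one, d_apply (by omega), d_apply (by omega)]
      exact hxy ⟨i, by omega⟩ (by simpa [Fin.ext_iff] using hi)
    rw [map_mul, map_inv, mul_inv_eq_one, ← δ_apply, ← δ_apply] at this
    exact this

theorem IsMinimal.facesTrivial (h : G.IsMinimal) : G.FacesTrivial := by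
  intro n k z hk hz
  have := h.face_eq n ⟨k, by omega⟩ z (1 : G _⦋n + 1⦌) fun i hi => by
    change (G.δ i).hom z = (G.δ i).hom 1
    rw [δ_apply, hz i (by simpa [Fin.ext_iff] using hi) (by omega), map_one]
  change (G.δ _).hom z = (G.δ _).hom 1 at this
  rwa [map_one, ← d_apply] at this

/-- It suffices to test the face `d₀`. -/
theorem facesTrivial_of_zero (h : ∀ (n : ℕ) (z : G _⦋n + 1⦌),
    (∀ i, i ≠ 0 → i ≤ n + 1 → G.d n i z = 1) → G.d n 0 z = 1) : G.FacesTrivial := by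
  intro n k
  induction k with
  | zero => exact fun z _ hz => h n z hz
  | succ k ih =>
    intro z hk hz
    have hc : G.d n k (G.s n k (G.d n (k + 1) z)) = 1 := by
      -- This element moves the nontrivial face down by one: its `(k + 1)`-st face is 1, its `k`-th
      -- face is `d_{k+1} z`, and the others stay trivial.
      have := ih (z⁻¹ * G.s n k (G.d n (k + 1) z)) (by omega) fun i hi hi' => ?_
      · rwa [map_mul, map_inv, hz k (by omega) (by omega), inv_one, one_mul] at this
      · rw [map_mul, map_inv]
        by_cases hik : i = k + 1
        · subst hik
          rw [d_s_succ (by omega), inv_mul_cancel]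
        · rw [hz i hik hi', inv_one, one_mul]
          rcases Nat.lt_or_gt_of_ne hi with hlt | hgt
          · obtain ⟨n, rfl⟩ := Nat.exists_eq_add_one_of_ne_zero (show n ≠ 0 by omega)
            obtain ⟨k, rfl⟩ := Nat.exists_eq_add_one_of_ne_zero (show k ≠ 0 by omega)
            rw [d_s_of_le (by omega) (by omega),
              d_d (by omega) (by omega), hz i (by omega) (by omega), map_one, map_one]
          · obtain ⟨n, rfl⟩ := Nat.exists_eq_add_one_of_ne_zero (show n ≠ 0 by omega)
            obtain ⟨i, rfl⟩ := Nat.exists_eq_add_one_of_ne_zero (show i ≠ 0 by omega)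
            rw [d_s_of_gt (by omega) (by omega),
              ← d_d (by omega) (by omega), hz (i + 1) (by omega) (by omega), map_one, map_one]
    rwa [d_s_self (by omega)] at hc

theorem NormalSub.proj_eq_one_iff (N : G.NormalSub) {k : SimplexCategoryᵒᵖ} {x : G.obj k} :
    (N.proj.app k).hom x = 1 ↔ x ∈ N.carrier k :=
  QuotientGroup.eq_one_iff x

theorem NormalSub.proj_surjective (N : G.NormalSub) (k : SimplexCategoryᵒᵖ) :
    Function.Surjective (N.proj.app k).hom :=
  QuotientGroup.mk'_surjective _

theorem facesTrivial_quotient_boundaryClosure (G : SimplicialGroup.{u}) :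
    FacesTrivial (boundaryClosure G).quotient := by
  refine facesTrivial_of_zero fun n z hz => ?_
  obtain ⟨x, rfl⟩ := (boundaryClosure G).proj_surjective _ z
  simp only [← app_d, NormalSub.proj_eq_one_iff] at hz ⊢
  -- Dividing the lift `x` by an element of the subgroup with the same faces `d_i`, `i ≠ 0`, yields
  -- an honest Moore chain of `G`, whose `d₀` is a boundary.
  obtain ⟨v, hv, hvx⟩ := (boundaryClosure G).exists_filler_of_faces (by omega) x hz
  have h1 : G.d n 0 (x * v⁻¹) ∈ (boundaryClosure G).carrier (op ⦋n⦌) := by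
    refine NormalSub.subset_generated _ n (mem_boundaries_iff.2 ⟨x * v⁻¹, fun i h0 hi => ?_, rfl⟩)
    rw [map_mul, map_inv, hvx i h0 hi, mul_inv_cancel]
  have := mul_mem h1 ((boundaryClosure G).d_mem 0 hv)
  rwa [← map_mul, inv_mul_cancel_right] at this

/-- The kernel of a simplicial homomorphism. -/
def ker {G' : SimplicialGroup.{u}} (f : G ⟶ G') : G.NormalSub where
  carrier k := (f.app k).hom.ker
  normal _ := inferInstance
  map_mem {k l} g x hx := by
    rw [MonoidHom.mem_ker] at hx ⊢
    have := ConcreteCategory.congr_hom (f.naturality g) x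
    change (f.app l).hom ((G.map g).hom x) = (G'.map g).hom ((f.app k).hom x) at this
    rw [this, hx, map_one]

/-- Homomorphisms to simplicial groups with trivial boundaries kill the boundaries. -/
theorem boundaryClosure_le_ker {G' : SimplicialGroup.{u}} (h : G'.FacesTrivial) (f : G ⟶ G')
    (k : SimplexCategoryᵒᵖ) : (boundaryClosure G).carrier k ≤ (ker f).carrier k := by
  refine NormalSub.generated_le _ _ (fun n x hx => ?_) k
  obtain ⟨z, hz, rfl⟩ := mem_boundaries_iff.1 hx
  change (f.app _).hom _ = 1
  rw [app_d]
  refine h n 0 _ (by omega) fun i h0 hi => ?_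
  rw [← app_d, hz i h0 hi, map_one]

/-- The homomorphism out of a quotient induced by a homomorphism that kills `N`. -/
theorem NormalSub.existsUnique_desc (N : G.NormalSub) {G' : SimplicialGroup.{u}} (f : G ⟶ G')
    (h : ∀ k, N.carrier k ≤ (ker f).carrier k) : ∃! g : N.quotient ⟶ G', N.proj ≫ g = f := by
  refine ⟨{ app := fun k => GrpCat.ofHom (QuotientGroup.lift (N.carrier k) (f.app k).hom (h k))
            naturality := fun k l g => ?_ }, ?_, fun g hg => ?_⟩
  · ext x
    obtain ⟨x, rfl⟩ := N.proj_surjective k x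
    exact ConcreteCategory.congr_hom (f.naturality g) x
  · ext k x
    rfl
  · subst hg
    ext k x
    obtain ⟨x, rfl⟩ := N.proj_surjective k x
    rfl

end Minimal

end SimplicialGroup

/-! ### Quotients of Milnor's construction, presented by free groups. -/

namespace SimplicialGroup

section Presentation

variable (X : SSet.{u}) (x₀ : X _⦋0⦌)

theorem map_basePoint {n m : ℕ} (f : op ⦋n⦌ ⟶ op ⦋m⦌) :
    X.map f (basePoint X x₀ n) = basePoint X x₀ m := by
  change (X.map _ ≫ X.map f) x₀ = X.map _ x₀
  rw [← X.map_comp]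
  rfl

/-- The homomorphism from the free group on `X_n` to `F(X)_n`. -/
def milnorMk (n : ℕ) : FreeGroup (X _⦋n⦌) →* (milnorF X x₀) _⦋n⦌ :=
  ((milnorRel X x₀).proj.app (op ⦋n⦌)).hom

theorem milnorMk_surjective (n : ℕ) : Function.Surjective (milnorMk X x₀ n) :=
  (milnorRel X x₀).proj_surjective _

theorem milnorOf_basePoint (n : ℕ) : milnorOf X x₀ (basePoint X x₀ n) = 1 :=
  (milnorRel X x₀).proj_eq_one_iff.2 (NormalSub.subset_generated _ n rfl)

theorem rep_eq_one_of_milnorMk_eq_one {n : ℕ} {z : FreeGroup (X _⦋n⦌)}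
    (hz : milnorMk X x₀ n z = 1) : Magnus.rep (basePoint X x₀ n) z = 1 := by
  let φ : (free X) _⦋n⦌ →* (Module.End ℤ (List (X _⦋n⦌) →₀ ℤ))ˣ := Magnus.rep (basePoint X x₀ n)
  have h : (milnorRel X x₀).carrier (op ⦋n⦌) ≤ φ.ker := by
    refine Subgroup.normalClosure_le_normal ?_
    rintro _ ⟨m, f, _, rfl, rfl⟩
    change Magnus.rep _ (FreeGroup.of (X.map f (basePoint X x₀ m))) = 1
    rw [map_basePoint, Magnus.rep_eq_one_iff]
    exact Magnus.act_of_base _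
  exact h ((milnorRel X x₀).proj_eq_one_iff.1 hz)

theorem milnorMk_leftNormed {n : ℕ} (l : List (X _⦋n⦌)) :
    milnorMk X x₀ n (leftNormed (l.map FreeGroup.of)) = leftNormed (l.map (milnorOf X x₀)) := by
  rw [map_leftNormed, List.map_map]
  rfl

/-- The Magnus representation is well defined on Cohen's construction, since simplicial operators
preserve repeated entries and the base point. Using the image of its kernel in `F(X)_n` avoids
descending the representation itself. -/
theorem rep_eq_one_of_mem_cohenRel {n : ℕ} {z : FreeGroup (X _⦋n⦌)}
    (hz : milnorMk X x₀ n z ∈ (cohenRel X x₀).carrier (op ⦋n⦌)) :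
    Magnus.rep (basePoint X x₀ n) z = 1 := by
  have hn : ((Magnus.rep (basePoint X x₀ n)).ker.map (milnorMk X x₀ n)).Normal :=
    Subgroup.Normal.map inferInstance _ (milnorMk_surjective X x₀ n)
  have h : (cohenRel X x₀).carrier (op ⦋n⦌) ≤
      (Magnus.rep (basePoint X x₀ n)).ker.map (milnorMk X x₀ n) := by
    refine Subgroup.normalClosure_le_normal ?_
    rintro _ ⟨m, f, _, ⟨t, x, ⟨i, j, hij, hx⟩, rfl⟩, rfl⟩
    refine ⟨leftNormed ((List.ofFn fun i => X.map f (x i)).map FreeGroup.of),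
      Magnus.rep_leftNormed ?_, ?_⟩
    · rw [List.nodup_ofFn]
      exact fun h => hij.ne (h (congrArg (X.map f) hx))
    · rw [milnorMk_leftNormed, map_leftNormed, List.map_ofFn, List.map_ofFn]
      rfl
  obtain ⟨z', hz', e⟩ := h hz
  have : Magnus.rep (basePoint X x₀ n) (z'⁻¹ * z) = 1 :=
    rep_eq_one_of_milnorMk_eq_one X x₀ (by rw [map_mul, map_inv, e, inv_mul_cancel])
  rwa [map_mul, map_inv, MonoidHom.mem_ker.1 hz', inv_one, one_mul] at this

theorem cohenRel_of_not_nodup {n : ℕ} {l : List (X _⦋n⦌)} (hl : ¬ l.Nodup) :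
    leftNormed (l.map (milnorOf X x₀)) ∈ (cohenRel X x₀).carrier (op ⦋n⦌) := by
  refine NormalSub.subset_generated _ n ⟨l.length, l.get, ?_, ?_⟩
  · rw [List.nodup_iff_injective_get, Function.Injective] at hl
    push Not at hl
    obtain ⟨i, j, h, hne⟩ := hl
    rcases lt_or_gt_of_ne hne with h' | h'
    · exact ⟨i, j, h', h⟩
    · exact ⟨j, i, h', h.symm⟩
  · rw [← List.ofFn_get l, List.map_ofFn]
    simp [Function.comp_def]

theorem cohenRel_le {N : (milnorF X x₀).NormalSub}
    (h : ∀ (n : ℕ) (l : List (X _⦋n⦌)), ¬ l.Nodup →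
      leftNormed (l.map (milnorOf X x₀)) ∈ N.carrier (op ⦋n⦌)) (k : SimplexCategoryᵒᵖ) :
    (cohenRel X x₀).carrier k ≤ N.carrier k := by
  refine NormalSub.generated_le _ _ (fun n => ?_) k
  rintro _ ⟨t, x, ⟨i, j, hij, hx⟩, rfl⟩
  have := h n (List.ofFn x) (by rw [List.nodup_ofFn]; exact fun h => hij.ne (h hx))
  rwa [List.map_ofFn] at this

variable (N : (milnorF X x₀).NormalSub)

/-- The homomorphism from the free group on `X_n` to a quotient of `F(X)_n`. -/
def quotMk (n : ℕ) : FreeGroup (X _⦋n⦌) →* N.quotient _⦋n⦌ :=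
  (N.proj.app (op ⦋n⦌)).hom.comp (milnorMk X x₀ n)

variable {X x₀}

theorem quotMk_surjective (n : ℕ) : Function.Surjective (quotMk X x₀ N n) :=
  (N.proj_surjective _).comp (milnorMk_surjective X x₀ n)

theorem quotMk_eq_one_iff {n : ℕ} {z : FreeGroup (X _⦋n⦌)} :
    quotMk X x₀ N n z = 1 ↔ milnorMk X x₀ n z ∈ N.carrier (op ⦋n⦌) :=
  N.proj_eq_one_iff

theorem quotMk_basePoint (n : ℕ) : quotMk X x₀ N n (FreeGroup.of (basePoint X x₀ n)) = 1 := by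
  change (N.proj.app (op ⦋n⦌)).hom (milnorOf X x₀ _) = 1
  rw [milnorOf_basePoint, map_one]

theorem d_quotMk {n i : ℕ} (z : FreeGroup (X _⦋n + 1⦌)) :
    N.quotient.d n i (quotMk X x₀ N (n + 1) z) =
      quotMk X x₀ N n (FreeGroup.map (X.δ (Fin.ofNat (n + 2) i)) z) :=
  rfl

theorem s_quotMk {n i : ℕ} (z : FreeGroup (X _⦋n⦌)) :
    N.quotient.s n i (quotMk X x₀ N n z) =
      quotMk X x₀ N (n + 1) (FreeGroup.map (X.σ (Fin.ofNat (n + 1) i)) z) :=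
  rfl

theorem quotMk_leftNormed {n : ℕ} (l : List (X _⦋n⦌)) :
    quotMk X x₀ N n (leftNormed (l.map FreeGroup.of)) =
      (N.proj.app (op ⦋n⦌)).hom (leftNormed (l.map (milnorOf X x₀))) := by
  rw [← milnorMk_leftNormed]
  rfl

/-- In Cohen's construction, the normal closure of each generator is commutative. -/
theorem commute_cohenK (n : ℕ) (b : X _⦋n⦌) :
    ∀ u ∈ Subgroup.normalClosure {quotMk X x₀ (cohenRel X x₀) n (FreeGroup.of b)},
    ∀ v ∈ Subgroup.normalClosure {quotMk X x₀ (cohenRel X x₀) n (FreeGroup.of b)},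
      Commute u v := by
  intro u hu v hv
  refine commute_of_mem_normalClosure
    (y := fun b => quotMk X x₀ (cohenRel X x₀) n (FreeGroup.of b)) ?_ (fun l hl => ?_) b hu hv
  · have : Set.range (fun b => quotMk X x₀ (cohenRel X x₀) n (FreeGroup.of b)) =
        quotMk X x₀ (cohenRel X x₀) n '' Set.range FreeGroup.of := by
      rw [← Set.range_comp]
      rfl
    rw [this, ← MonoidHom.map_closure, FreeGroup.closure_range_of, ← MonoidHom.range_eq_map,
      MonoidHom.range_eq_top]
    exact quotMk_surjective _ n
  · have := quotMk_leftNormed (cohenRel X x₀) l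
    rw [map_leftNormed, List.map_map] at this
    refine this.trans ?_
    rw [NormalSub.proj_eq_one_iff]
    exact cohenRel_of_not_nodup X x₀ hl

end Presentation

end SimplicialGroup

/-! ### The simplices of the circle and their faces and degeneracies. -/

namespace Circle

open SimplicialGroup

/-- The monotone map `[n] → [1]` that is `0` on the first `j` elements. -/
def threshold (n j : ℕ) : Fin (n + 1) →o Fin 2 where
  toFun i := if (i : ℕ) < j then 0 else 1
  monotone' := by
    intro a b hab
    dsimp only
    split_ifs with h1 h2
    · exact le_rfl
    · exact Fin.zero_le _
    · exact absurd h1 (by have := Fin.le_def.1 hab; omega)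
    · exact le_rfl

/-- The `n`-simplex of the circle represented by the monotone map that is `0` on the first `j`
vertices. -/
def y (n j : ℕ) : simplicialCircle.{u} _⦋n⦌ :=
  Quotient.mk (collapseSetoid (SSet.boundary.{u} 1) (op ⦋n⦌))
    (SSet.stdSimplex.objMk (threshold n j))

theorem const_mem_boundary {n : ℕ} {x : Δ[1] _⦋n⦌} (c : Fin 2) (h : ∀ i, x i = c) :
    x ∈ (SSet.boundary.{u} 1).obj (op ⦋n⦌) := by
  rw [SSet.mem_boundary_iff_notMem_range]
  refine ⟨1 - c, ?_⟩
  rintro ⟨i, hi⟩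
  rw [h] at hi
  revert hi
  fin_cases c <;> decide

theorem y_eq_base {n j : ℕ} (h : j = 0 ∨ n + 1 ≤ j) :
    y.{u} n j = basePoint simplicialCircle.{u} circleBase n := by
  refine Quotient.sound (.inr ⟨?_, const_mem_boundary 0 fun i => rfl⟩)
  rcases h with rfl | h
  · exact const_mem_boundary 1 fun i => rfl
  · exact const_mem_boundary 0 fun i => if_pos (lt_of_lt_of_le (show (i : ℕ) < n + 1 from i.2) h)

/-- A nonconstant threshold map is onto, hence outside the boundary, and its values determine the
threshold. -/
theorem y_inj {n j j' : ℕ} (h : y.{u} n j = y n j') : j = j' ∨ (j = 0 ∨ n + 1 ≤ j) ∧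
    (j' = 0 ∨ n + 1 ≤ j') := by
  have key (j : ℕ) (hj : SSet.stdSimplex.objMk (threshold n j) ∈ (SSet.boundary.{u} 1).obj (op ⦋n⦌)) : j = 0 ∨ n + 1 ≤ j := by
    by_contra hc
    rw [SSet.mem_boundary_iff_notMem_range] at hj
    obtain ⟨c, hc'⟩ := hj
    refine hc' ?_
    fin_cases c
    · exact ⟨⟨0, by omega⟩, if_pos (by simp only; omega)⟩
    · exact ⟨⟨j, by omega⟩, if_neg (by simp only; omega)⟩
  rcases Quotient.exact h with h | ⟨h1, h2⟩
  · have h (i : ℕ) (hi : i < n + 1) : i < j ↔ i < j' := by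
      have := DFunLike.congr_fun h ⟨i, hi⟩
      change (if i < j then (0 : Fin 2) else 1) = (if i < j' then 0 else 1) at this
      split_ifs at this with a b b
      all_goals omega
    rcases Nat.lt_trichotomy j j' with hlt | rfl | hlt
    · by_cases hj : j < n + 1
      · have := h j hj
        omega
      · omega
    · exact .inl rfl
    · by_cases hj : j' < n + 1
      · have := h j' hj
        omega
      · omega
  · exact .inr ⟨key j h1, key j' h2⟩

theorem exists_eq_y {n : ℕ} (x : simplicialCircle.{u} _⦋n⦌) : ∃ j ≤ n, x = y n j := by
  classical
  have ne_zero : ∀ c : Fin 2, c ≠ 0 → c = 1 := by decide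
  have one_le : ∀ c : Fin 2, 1 ≤ c → c = 1 := by decide
  obtain ⟨(x : Δ[1] _⦋n⦌), rfl⟩ := Quotient.exists_rep x
  by_cases h : ∃ j, ∃ hj : j < n + 1, x ⟨j, hj⟩ = 1
  · obtain ⟨hj, h1⟩ := Nat.find_spec h
    refine ⟨Nat.find h, by omega, congrArg _ (SSet.stdSimplex.ext _ _ fun i => ?_)⟩
    change x i = if (i : ℕ) < Nat.find h then 0 else 1
    split_ifs with hi
    · have := Nat.find_min h hi
      by_contra h0
      exact this ⟨i.2, ne_zero _ h0⟩
    · have := SSet.stdSimplex.monotone_apply x (show ⟨Nat.find h, hj⟩ ≤ i from Fin.le_def.2 (by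
        simp only; omega))
      dsimp only at this
      rw [h1] at this
      exact one_le _ this
  -- The constant map 0 has threshold `n + 1`, beyond the allowed range; in the circle it is the
  -- base point, as is threshold 0.
  · refine ⟨0, by omega, ?_⟩
    rw [y_eq_base (.inl rfl), ← y_eq_base (.inr le_rfl)]
    refine congrArg _ (SSet.stdSimplex.ext _ _ fun i => ?_)
    change x i = if (i : ℕ) < n + 1 then 0 else 1
    rw [if_pos i.2]
    by_contra h0
    exact h ⟨i, i.2, ne_zero _ h0⟩

/-- The index `j` counts the vertices sent to 0, and `d_i` omits one of these exactly when `i < j`.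
So `d_0` kills `y_1`, the last face kills `y_{n+1}`, and an inner `d_i` identifies `y_i` with
`y_{i+1}`. -/
theorem δ_y {n i j : ℕ} (hi : i ≤ n + 1) :
    simplicialCircle.{u}.δ (Fin.ofNat (n + 2) i) (y (n + 1) j) =
      if i < j then y n (j - 1) else y n j := by
  have key (j' : ℕ) (h : ∀ k, k < n + 1 → ((if k < i then k else k + 1) < j ↔ k < j')) :
      simplicialCircle.{u}.δ (Fin.ofNat (n + 2) i) (y (n + 1) j) = y n j' := by
    refine congrArg (Quotient.mk _) (SSet.stdSimplex.ext _ _ fun k => ?_)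
    change (if (((Fin.ofNat (n + 2) i).succAbove k : Fin (n + 2)) : ℕ) < j then (0 : Fin 2) else 1) =
      if (k : ℕ) < j' then 0 else 1
    have hk : (((Fin.ofNat (n + 2) i).succAbove k : Fin (n + 2)) : ℕ) =
        if (k : ℕ) < i then (k : ℕ) else k + 1 := by
      rw [ofNat_eq_mk (by omega), Fin.succAbove]
      simp only [Fin.lt_def, Fin.val_castSucc]
      split_ifs <;> rfl
    rw [hk]
    simp only [h k k.2]
  split_ifs with hij
  · exact key _ fun k hk => by split_ifs <;> omega
  · exact key _ fun k hk => by split_ifs <;> omega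

theorem σ_y {n i j : ℕ} (hi : i ≤ n) :
    simplicialCircle.{u}.σ (Fin.ofNat (n + 1) i) (y n j) =
      if i < j then y (n + 1) (j + 1) else y (n + 1) j := by
  have key (j' : ℕ) (h : ∀ k, k < n + 2 → ((if i < k then k - 1 else k) < j ↔ k < j')) :
      simplicialCircle.{u}.σ (Fin.ofNat (n + 1) i) (y n j) = y (n + 1) j' := by
    refine congrArg (Quotient.mk _) (SSet.stdSimplex.ext _ _ fun k => ?_)
    change (if (((Fin.ofNat (n + 1) i).predAbove k : Fin (n + 1)) : ℕ) < j then (0 : Fin 2) else 1) =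
      if (k : ℕ) < j' then 0 else 1
    have hk : (((Fin.ofNat (n + 1) i).predAbove k : Fin (n + 1)) : ℕ) =
        if i < (k : ℕ) then (k : ℕ) - 1 else k := by
      rw [ofNat_eq_mk (by omega), Fin.predAbove]
      simp only [Fin.lt_def, Fin.val_castSucc]
      split_ifs <;> rfl
    rw [hk]
    simp only [h k k.2]
  split_ifs with hij
  · exact key _ fun k hk => by split_ifs <;> omega
  · exact key _ fun k hk => by split_ifs <;> omega

instance (n : ℕ) : Finite (simplicialCircle.{u} _⦋n⦌) :=
  Finite.of_surjective (fun j : Fin (n + 1) => y n j) fun x => by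
    obtain ⟨j, hj, rfl⟩ := exists_eq_y x
    exact ⟨⟨j, by omega⟩, rfl⟩

end Circle

theorem commute_of_commute_normalClosure {H : Type*} [Group H] {a : H}
    (h : ∀ v ∈ Subgroup.normalClosure {a}, Commute a v) :
    ∀ u ∈ Subgroup.normalClosure {a}, ∀ v ∈ Subgroup.normalClosure {a}, Commute u v := by
  have hle : Subgroup.normalClosure {a} ≤
      Subgroup.centralizer (Subgroup.normalClosure {a} : Set H) := by
    refine Subgroup.normalClosure_le_normal ?_
    rintro _ rfl
    rw [SetLike.mem_coe, Subgroup.mem_centralizer_iff]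
    exact fun v hv => (h v hv).symm
  exact fun u hu v hv => Subgroup.mem_centralizer_iff.1 (hle hv) u hu

theorem map_mem_normalClosure {H H' : Type*} [Group H] [Group H'] (f : H →* H') {a v : H}
    (hv : v ∈ Subgroup.normalClosure {a}) : f v ∈ Subgroup.normalClosure {f a} := by
  have : Subgroup.normalClosure {a} ≤ (Subgroup.normalClosure {f a}).comap f := by
    refine Subgroup.normalClosure_le_normal ?_
    rintro _ rfl
    exact Subgroup.subset_normalClosure (Set.mem_singleton _)
  exact this hv

namespace Magnus

/-- If `φ` identifies precisely the letters `p` and `q`, kills the Magnus expansion of `z`, and no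
nonempty word without `p` occurs in it, then no nonempty word without `q` does. -/
theorem expansion_apply_eq_zero_of_identify {α β : Type*} {x₀ : α} {y₀ : β} {φ : α → β}
    (hφ : φ x₀ = y₀) {p q : α} (hpq : φ p = φ q) (hp0 : p ≠ x₀) (hq0 : q ≠ x₀)
    (hinj : ∀ x x', φ x = φ x' → x = x' ∨ (x = p ∨ x = q) ∧ (x' = p ∨ x' = q))
    {z : FreeGroup α} (hz : expansion y₀ (FreeGroup.map φ z) = Finsupp.single [] 1)
    (hp : ∀ w : List α, w ≠ [] → w.Nodup → x₀ ∉ w → p ∉ w → expansion x₀ z w = 0)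
    {w : List α} (hne : w ≠ []) (hw : w.Nodup) (h0 : x₀ ∉ w) (hq : q ∉ w) :
    expansion x₀ z w = 0 := by
  classical
  by_cases hpw : p ∈ w
  -- The swapped word has `q` in place of `p`, so it avoids `p` and its coefficient vanishes by
  -- `hp`.
  · have := expansion_apply_add_swap hφ hpq hp0 hq0 hinj hz hw h0 hpw hq
    rwa [hp (w.map (Equiv.swap p q)), add_zero] at this
    · simpa using hne
    · exact hw.map (Equiv.injective _)
    · rw [List.mem_map]
      rintro ⟨a, ha, h⟩
      rw [Equiv.swap_apply_eq_iff, Equiv.swap_apply_of_ne_of_ne hp0.symm hq0.symm] at h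
      exact h0 (h ▸ ha)
    · rw [List.mem_map]
      rintro ⟨a, ha, h⟩
      rw [Equiv.swap_apply_eq_iff, Equiv.swap_apply_left] at h
      exact hq (h ▸ ha)
  · exact hp w hne hw h0 hpw

end Magnus

/-! ### Minimality of K(S¹) through Magnus expansions. -/

namespace Circle

open SimplicialGroup Magnus

/-- The base point of the circle in degree `n`. -/
abbrev base (n : ℕ) : simplicialCircle.{u} _⦋n⦌ := basePoint simplicialCircle.{u} circleBase n

/-- Faces of the circle, indexed by natural numbers. -/
abbrev face (n i : ℕ) : simplicialCircle.{u} _⦋n + 1⦌ → simplicialCircle.{u} _⦋n⦌ :=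
  simplicialCircle.{u}.δ (Fin.ofNat (n + 2) i)

theorem face_base (n i : ℕ) : face.{u} n i (base (n + 1)) = base n :=
  map_basePoint _ _ (SimplexCategory.δ (Fin.ofNat (n + 2) i)).op

theorem y_ne_base {n j : ℕ} (h0 : j ≠ 0) (hj : j ≤ n) : y.{u} n j ≠ base n := by
  intro h
  have := y_inj (h.trans (y_eq_base (j := 0) (.inl rfl)).symm)
  omega

theorem face_y_self {n i : ℕ} (hi : i ≤ n) :
    face.{u} n i (y (n + 1) i) = face n i (y (n + 1) (i + 1)) := by
  rw [face, δ_y (by omega), δ_y (by omega), if_neg (by omega), if_pos (by omega)]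
  rfl

theorem face_inj {n i : ℕ} (hi : i ≤ n) (x x' : simplicialCircle.{u} _⦋n + 1⦌)
    (h : face n i x = face n i x') : x = x' ∨ (x = y (n + 1) i ∨ x = y (n + 1) (i + 1)) ∧
      (x' = y (n + 1) i ∨ x' = y (n + 1) (i + 1)) := by
  obtain ⟨j, hj, rfl⟩ := exists_eq_y x
  obtain ⟨j', hj', rfl⟩ := exists_eq_y x'
  rw [face, δ_y (by omega), δ_y (by omega)] at h
  suffices j = j' ∨ (j = i ∨ j = i + 1) ∧ (j' = i ∨ j' = i + 1) by
    rcases this with rfl | ⟨rfl | rfl, rfl | rfl⟩ <;> simp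
  split_ifs at h <;> have := y_inj h <;> omega

theorem face_last_inj {n : ℕ} (x x' : simplicialCircle.{u} _⦋n + 1⦌)
    (h : face n (n + 1) x = face n (n + 1) x') : x = x' ∨
      (x = y (n + 1) (n + 1) ∨ x = base (n + 1)) ∧
      (x' = y (n + 1) (n + 1) ∨ x' = base (n + 1)) := by
  obtain ⟨j, hj, rfl⟩ := exists_eq_y x
  obtain ⟨j', hj', rfl⟩ := exists_eq_y x'
  rw [face, δ_y (by omega), δ_y (by omega), if_neg (by omega), if_neg (by omega)] at h
  rw [base, ← y_eq_base (j := 0) (.inl rfl)]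
  suffices j = j' ∨ (j = n + 1 ∨ j = 0) ∧ (j' = n + 1 ∨ j' = 0) by
    rcases this with rfl | ⟨rfl | rfl, rfl | rfl⟩ <;> simp
  have := y_inj h
  omega

/-- The Magnus expansion is trivial. -/
def IsTrivialExpansion (n : ℕ) (z : FreeGroup (simplicialCircle.{u} _⦋n⦌)) : Prop :=
  expansion (base n) z = Finsupp.single [] 1

/-- Each nonempty reduced word in the Magnus expansion contains the letter `y n j`. -/
def Involves (n j : ℕ) (z : FreeGroup (simplicialCircle.{u} _⦋n⦌)) : Prop :=
  ∀ w : List (simplicialCircle.{u} _⦋n⦌), w ≠ [] → w.Nodup → base n ∉ w → y n j ∉ w →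
    expansion (base n) z w = 0

/-- If the inner faces of the expansion are trivial, and one letter is involved, then all are. -/
theorem Involves.all {n : ℕ} {z : FreeGroup (simplicialCircle.{u} _⦋n + 1⦌)}
    (hd : ∀ i, 1 ≤ i → i ≤ n → IsTrivialExpansion n (FreeGroup.map (face n i) z)) {b : ℕ}
    (hb1 : 1 ≤ b) (hb2 : b ≤ n + 1) (hb : Involves (n + 1) b z) {j : ℕ} (hj1 : 1 ≤ j)
    (hj2 : j ≤ n + 1) : Involves (n + 1) j z := by
  -- The `j`-th face identifies the neighbours `y_j` and `y_{j+1}`, so involvement spreads in both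
  -- directions.
  have up (j : ℕ) (hj1 : 1 ≤ j) (hj2 : j ≤ n) (h : Involves (n + 1) j z) :
      Involves (n + 1) (j + 1) z := fun _ hne hw h0 hq =>
    expansion_apply_eq_zero_of_identify (face_base n j) (face_y_self hj2)
      (y_ne_base (by omega) (by omega)) (y_ne_base (by omega) (by omega)) (face_inj hj2)
      (hd j hj1 hj2) h hne hw h0 hq
  have down (j : ℕ) (hj1 : 1 ≤ j) (hj2 : j ≤ n) (h : Involves (n + 1) (j + 1) z) :
      Involves (n + 1) j z := fun _ hne hw h0 hq =>
    expansion_apply_eq_zero_of_identify (face_base n j) (face_y_self hj2).symm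
      (y_ne_base (by omega) (by omega)) (y_ne_base (by omega) (by omega))
      (fun x x' h => by simpa only [or_comm] using face_inj hj2 x x' h)
      (hd j hj1 hj2) h hne hw h0 hq
  rcases le_total b j with h | h
  · induction j, h using Nat.le_induction with
    | base => exact hb
    | succ j hbj ih => exact up j (by omega) (by omega) (ih (by omega) (by omega))
  · have (r : ℕ) : ∀ j, 1 ≤ j → j + r = b → Involves (n + 1) j z := by
      induction r with
      | zero => rintro j - rfl; exact hb
      | succ r ih => exact fun j hj hjr => down j hj (by omega) (ih (j + 1) (by omega) (by omega))
    exact this (b - j) j hj1 (by omega)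

theorem Involves.face_zero {n : ℕ} {z : FreeGroup (simplicialCircle.{u} _⦋n + 1⦌)}
    (h : Involves (n + 1) 1 z) : IsTrivialExpansion n (FreeGroup.map (face n 0) z) := by
  refine expansion_map_eq_of_kill (face_base n 0) fun w hne hw h0 hm => h w hne hw h0 fun hy => hm ?_
  refine List.mem_map.2 ⟨_, hy, ?_⟩
  rw [face, δ_y (by omega), if_pos (by omega), y_eq_base (.inl rfl)]

theorem Involves.face_last {n : ℕ} {z : FreeGroup (simplicialCircle.{u} _⦋n + 1⦌)}
    (h : Involves (n + 1) (n + 1) z) :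
    IsTrivialExpansion n (FreeGroup.map (face n (n + 1)) z) := by
  refine expansion_map_eq_of_kill (face_base n (n + 1)) fun w hne hw h0 hm =>
    h w hne hw h0 fun hy => hm ?_
  refine List.mem_map.2 ⟨_, hy, ?_⟩
  rw [face, δ_y (by omega), if_neg (by omega), y_eq_base (.inr le_rfl)]

/-- Cohen's construction on the circle has trivial boundaries. -/
theorem facesTrivial_KCircle : KCircle.{u}.FacesTrivial := by
  refine facesTrivial_of_zero fun n z hz => ?_
  obtain ⟨z, rfl⟩ := quotMk_surjective _ _ z
  have hd (i : ℕ) (h0 : i ≠ 0) (hi : i ≤ n + 1) :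
      IsTrivialExpansion n (FreeGroup.map (face n i) z) :=
    expansion_eq_of_rep_eq_one (rep_eq_one_of_mem_cohenRel _ _
      ((quotMk_eq_one_iff _).1 ((d_quotMk _ z).symm.trans (hz i h0 hi))))
  -- The last face collapses only `y_{n+1}`, so a word avoiding this letter would survive in a
  -- trivial expansion.
  have hlast : Involves (n + 1) (n + 1) z := fun w hne hw h0 hp =>
    expansion_apply_eq_zero_of_kill (face_base n (n + 1)) face_last_inj
      (hd (n + 1) (by omega) le_rfl) hw h0 hp hne
  have h1 := (hlast.all (fun i h1 h2 => hd i (by omega) (by omega)) (by omega) le_rfl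
    (j := 1) le_rfl (by omega)).face_zero
  exact (d_quotMk _ z).trans (map_eq_one_of_expansion_eq (quotMk_basePoint _ n)
    (commute_cohenK n) h1)

/-! ### F(S¹) modulo boundaries satisfies Cohen's relations. -/

/-- The normal simplicial subgroup of `F(S¹)` generated by the boundaries. -/
abbrev bd : FCircle.{u}.NormalSub := boundaryClosure FCircle.{u}

theorem bd_le_cohenRel (k : SimplexCategoryᵒᵖ) :
    bd.{u}.carrier k ≤ (cohenRel simplicialCircle.{u} circleBase).carrier k := fun _ hx =>
  (cohenRel simplicialCircle.{u} circleBase).proj_eq_one_iff.1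
    (boundaryClosure_le_ker facesTrivial_KCircle circleProj.{u} k hx)

/-- The homomorphism from the free group to the quotient of `F(S¹)` by the boundaries. -/
abbrev mk (n : ℕ) : FreeGroup (simplicialCircle.{u} _⦋n⦌) →* bd.{u}.quotient _⦋n⦌ :=
  quotMk simplicialCircle.{u} circleBase bd n

theorem isTrivialExpansion_of_mk_eq_one {n : ℕ} {z : FreeGroup (simplicialCircle.{u} _⦋n⦌)}
    (h : mk n z = 1) : IsTrivialExpansion n z :=
  expansion_eq_of_rep_eq_one (rep_eq_one_of_mem_cohenRel _ _
    (bd_le_cohenRel _ ((quotMk_eq_one_iff _).1 h)))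

/-- The generators of the quotient of `F(S¹)` by the boundaries. -/
def gen (n j : ℕ) : bd.{u}.quotient _⦋n⦌ := mk n (FreeGroup.of (y n j))

theorem gen_eq_one {n j : ℕ} (h : j = 0 ∨ n + 1 ≤ j) : gen.{u} n j = 1 := by
  rw [gen, y_eq_base h]
  exact quotMk_basePoint _ n

theorem d_gen {n i j : ℕ} (hi : i ≤ n + 1) :
    bd.{u}.quotient.d n i (gen (n + 1) j) = if i < j then gen n (j - 1) else gen n j := by
  refine (d_quotMk bd.{u} _).trans ?_
  rw [FreeGroup.map.of, δ_y hi]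
  split_ifs <;> rfl

theorem s_gen {n i j : ℕ} (hi : i ≤ n) :
    bd.{u}.quotient.s n i (gen n j) = if i < j then gen (n + 1) (j + 1) else gen (n + 1) j := by
  refine (s_quotMk bd.{u} _).trans ?_
  rw [FreeGroup.map.of, σ_y hi]
  split_ifs <;> rfl

/-- Cycles commute with the generators. -/
theorem commute_gen_of_cycle {n : ℕ} {v : bd.{u}.quotient _⦋n + 1⦌}
    (hv : ∀ i, i ≤ n + 1 → bd.{u}.quotient.d n i v = 1) (k : ℕ) (hk : k ≤ n + 2) :
    Commute (gen (n + 1) k) v := by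
  induction k with
  | zero =>
    rw [gen_eq_one (.inl rfl)]
    exact Commute.one_left v
  | succ k ih =>
    -- The faces of this commutator are `⁅gen k, v⁆` at `k`, trivial by induction, `⁅gen (k + 1),
    -- v⁆` at `k + 1`, and 1 elsewhere because `v` is a cycle. Minimality forces the face at `k + 1`
    -- to be trivial.
    have := facesTrivial_quotient_boundaryClosure FCircle.{u} (n + 1) (k + 1)
      ⁅gen (n + 2) (k + 1), bd.{u}.quotient.s (n + 1) k v⁆ (by omega) fun i hi hi' => ?_
    · rw [map_commutatorElement, d_gen (by omega), if_neg (by omega), d_s_succ (by omega)] at this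
      exact commutatorElement_eq_one_iff_commute.1 this
    · rw [map_commutatorElement]
      rcases Nat.lt_trichotomy i k with h | rfl | h
      · obtain ⟨k, rfl⟩ := Nat.exists_eq_add_one_of_ne_zero (show k ≠ 0 by omega)
        rw [d_s_of_le (by omega) (by omega), hv i (by omega), map_one, commutatorElement_one_right]
      · rw [d_s_self (by omega), d_gen (by omega), if_pos (by omega)]
        exact commutatorElement_eq_one_iff_commute.2 (ih (by omega))
      · obtain ⟨i, rfl⟩ := Nat.exists_eq_add_one_of_ne_zero (show i ≠ 0 by omega)
        rw [d_s_of_gt (by omega) (by omega), hv i (by omega), map_one, commutatorElement_one_right]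

/-- The normal closures of the generators in degree `n` are commutative. -/
def GensCommute (n : ℕ) : Prop :=
  ∀ j, ∀ u ∈ Subgroup.normalClosure {gen.{u} n j}, ∀ v ∈ Subgroup.normalClosure {gen.{u} n j},
    Commute u v

/-- Such a `v` is a cycle. All words of a lift contain `y_b`, hence every letter, so the outer faces
have trivial expansion; they are trivial because `ih` makes the expansion injective in degree `n`.
-/
theorem commute_gen_of_inner_faces {n : ℕ} (ih : GensCommute.{u} n) {b : ℕ} (hb1 : 1 ≤ b) (hb2 : b ≤ n + 1)
    {v : bd.{u}.quotient _⦋n + 1⦌} (hv : v ∈ Subgroup.normalClosure {gen (n + 1) b})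
    (hd : ∀ i, 1 ≤ i → i ≤ n → bd.{u}.quotient.d n i v = 1) : Commute (gen (n + 1) b) v := by
  obtain ⟨z, hz, rfl⟩ : ∃ z ∈ Subgroup.normalClosure {FreeGroup.of (y.{u} (n + 1) b)},
      mk (n + 1) z = v := by
    have := Subgroup.map_normalClosure {FreeGroup.of (y.{u} (n + 1) b)} (mk.{u} (n + 1))
      (quotMk_surjective _ _)
    rw [Set.image_singleton] at this
    exact (Subgroup.mem_map.1 (this.symm ▸ hv))
  have hd' (i : ℕ) (h1 : 1 ≤ i) (h2 : i ≤ n) :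
      IsTrivialExpansion n (FreeGroup.map (face n i) z) :=
    isTrivialExpansion_of_mk_eq_one ((d_quotMk _ z).symm.trans (hd i h1 h2))
  have hall {j : ℕ} (hj1 : 1 ≤ j) (hj2 : j ≤ n + 1) : Involves (n + 1) j z :=
    Involves.all hd' hb1 hb2 (fun _ hne _ _ hb => expansion_apply_eq_zero hz hb hne) hj1 hj2
  have hone {z : FreeGroup (simplicialCircle.{u} _⦋n⦌)} (h : IsTrivialExpansion n z) :
      mk n z = 1 := by
    refine map_eq_one_of_expansion_eq (quotMk_basePoint _ n) (fun x => ?_) h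
    obtain ⟨j, -, rfl⟩ := exists_eq_y x
    exact ih j
  refine commute_gen_of_cycle (fun i hi => ?_) b (by omega)
  rcases Nat.eq_zero_or_pos i with rfl | h0
  · exact (d_quotMk _ z).trans (hone (hall le_rfl (by omega)).face_zero)
  · by_cases h : i ≤ n
    · exact hd i h0 h
    · obtain rfl : i = n + 1 := by omega
      exact (d_quotMk _ z).trans (hone (hall (by omega) le_rfl).face_last)

/-- Splitting off a degenerate factor that omits a letter other than `b`. -/
theorem commute_gen_of_mul_inv {n : ℕ} (ih : GensCommute.{u} n) {b i t : ℕ} (hi : i ≤ n) (hit : i < b ∧ i = t + 1 ∨ b ≤ i ∧ i = t)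
    {v : bd.{u}.quotient _⦋n + 1⦌} (hv : v ∈ Subgroup.normalClosure {gen (n + 1) b})
    (h : ∀ v' ∈ Subgroup.normalClosure {gen.{u} (n + 1) b},
      v' = v * (bd.{u}.quotient.s n t (bd.{u}.quotient.d n i v))⁻¹ → Commute (gen (n + 1) b) v') :
    Commute (gen (n + 1) b) v := by
  -- The choice of `t` on either side of `b` makes `s_t d_i` fix the generator `b`, so it preserves
  -- its normal closure.
  have hgen : bd.{u}.quotient.s n t (bd.{u}.quotient.d n i (gen (n + 1) b)) = gen (n + 1) b := by
    rw [d_gen (by omega)]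
    split_ifs with h
    · rw [s_gen (by omega), if_pos (by omega), Nat.sub_add_cancel (by omega)]
    · rw [s_gen (by omega), if_neg (by omega)]
  have hdv := map_mem_normalClosure (bd.{u}.quotient.d n i) hv
  have hmem := map_mem_normalClosure (bd.{u}.quotient.s n t) hdv
  rw [hgen] at hmem
  -- This is the image under `s_t` of a commutation in degree `n`, where `ih` applies.
  have h1 : Commute (gen (n + 1) b) (bd.{u}.quotient.s n t (bd.{u}.quotient.d n i v)) := by
    conv_lhs => rw [← hgen]
    refine Commute.map ?_ (bd.{u}.quotient.s n t)
    obtain ⟨j, hj⟩ : ∃ j, bd.{u}.quotient.d n i (gen (n + 1) b) = gen n j := by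
      rw [d_gen (by omega)]
      split_ifs
      · exact ⟨_, rfl⟩
      · exact ⟨_, rfl⟩
    rw [hj] at hdv ⊢
    exact ih j _ (Subgroup.subset_normalClosure (Set.mem_singleton _)) _ hdv
  have h2 := h _ (mul_mem hv (inv_mem hmem)) rfl
  simpa using h2.mul_right h1

/-- The inner faces are made trivial one by one: those below `b` in decreasing order, with `s_{i-1}
d_i`, then the others in increasing order, with `s_i d_i`. In this order no correction spoils a face
that is already trivial. -/
theorem commute_gen {n : ℕ} (ih : GensCommute.{u} n) {b : ℕ} (hb1 : 1 ≤ b) (hb2 : b ≤ n + 1)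
    {v : bd.{u}.quotient _⦋n + 1⦌} (hv : v ∈ Subgroup.normalClosure {gen (n + 1) b}) :
    Commute (gen (n + 1) b) v := by
  have upper (r : ℕ) : ∀ t, t + r = n + 1 → b ≤ t →
      ∀ v ∈ Subgroup.normalClosure {gen.{u} (n + 1) b},
      (∀ i, 1 ≤ i → i < t → bd.{u}.quotient.d n i v = 1) → Commute (gen (n + 1) b) v := by
    induction r with
    | zero =>
      intro t ht _ v hv hd
      exact commute_gen_of_inner_faces ih hb1 hb2 hv fun i h1 h2 => hd i h1 (by omega)
    | succ r IH =>
      intro t ht hbt v hv hd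
      refine commute_gen_of_mul_inv ih (i := t) (t := t) (by omega) (by omega) hv fun v' hv' e =>
        IH (t + 1) (by omega) (by omega) v' hv' fun l hl1 hl2 => ?_
      rw [e, map_mul, map_inv]
      by_cases hlt : l = t
      · subst hlt
        rw [d_s_self (by omega), mul_inv_cancel]
      · obtain ⟨n, rfl⟩ := Nat.exists_eq_add_one_of_ne_zero (show n ≠ 0 by omega)
        obtain ⟨t, rfl⟩ := Nat.exists_eq_add_one_of_ne_zero (show t ≠ 0 by omega)
        rw [d_s_of_le (by omega) (by omega), d_d (by omega) (by omega), hd l hl1 (by omega),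
          map_one, map_one, inv_one, mul_one]
  have lower (t : ℕ) (ht : 1 ≤ t) : t ≤ b →
      ∀ v ∈ Subgroup.normalClosure {gen.{u} (n + 1) b},
      (∀ i, t ≤ i → i < b → bd.{u}.quotient.d n i v = 1) → Commute (gen (n + 1) b) v := by
    induction t, ht using Nat.le_induction with
    | base =>
      intro _ v hv hd
      exact upper (n + 1 - b) b (by omega) le_rfl v hv hd
    | succ t ht IH =>
      intro htb v hv hd
      obtain ⟨t, rfl⟩ := Nat.exists_eq_add_one_of_ne_zero (show t ≠ 0 by omega)
      refine commute_gen_of_mul_inv ih (i := t + 1) (t := t) (by omega) (by omega) hv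
        fun v' hv' e => IH (by omega) v' hv' fun l hl1 hl2 => ?_
      rw [e, map_mul, map_inv]
      by_cases hlt : l = t + 1
      · subst hlt
        rw [d_s_succ (by omega), mul_inv_cancel]
      · obtain ⟨n, rfl⟩ := Nat.exists_eq_add_one_of_ne_zero (show n ≠ 0 by omega)
        obtain ⟨l, rfl⟩ := Nat.exists_eq_add_one_of_ne_zero (show l ≠ 0 by omega)
        rw [d_s_of_gt (by omega) (by omega), ← d_d (by omega) (by omega),
          hd (l + 1) (by omega) (by omega), map_one, map_one, inv_one, mul_one]
  exact lower b hb1 le_rfl v hv fun i h1 h2 => absurd h1 (by omega)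

/-- The normal closure of each generator in `F(S¹)` modulo boundaries is commutative. -/
theorem gensCommute (n : ℕ) : GensCommute.{u} n := by
  induction n with
  | zero =>
    refine fun j => commute_of_commute_normalClosure fun v _ => ?_
    rw [gen_eq_one (by omega)]
    exact Commute.one_left v
  | succ n ih =>
    refine fun j => commute_of_commute_normalClosure fun v hv => ?_
    by_cases hj : 1 ≤ j ∧ j ≤ n + 1
    · exact commute_gen ih hj.1 hj.2 hv
    · rw [gen_eq_one (by omega)]
      exact Commute.one_left v

/-- Commutative normal closures of the generators kill every left-normed commutator with a repeated
entry, so `gensCommute` suffices. -/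
theorem cohenRel_le_bd (k : SimplexCategoryᵒᵖ) :
    (cohenRel simplicialCircle.{u} circleBase).carrier k ≤ bd.{u}.carrier k := by
  refine cohenRel_le _ _ (fun n l hl => ?_) k
  rw [← NormalSub.proj_eq_one_iff, ← quotMk_leftNormed, map_leftNormed, List.map_map,
    ← Subgroup.mem_bot]
  refine leftNormed_mem_of_not_nodup
    (fun x => Subgroup.normalClosure {mk n (FreeGroup.of x)})
    (fun x => Subgroup.subset_normalClosure (Set.mem_singleton _)) (fun x u hu v hv => ?_) hl
  obtain ⟨j, -, rfl⟩ := exists_eq_y x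
  rw [Subgroup.mem_bot]
  exact commutatorElement_eq_one_iff_commute.2 (gensCommute n j u hu v hv)

theorem cohenRel_eq_bd : cohenRel simplicialCircle.{u} circleBase = bd.{u} :=
  NormalSub.ext (funext fun k => le_antisymm (cohenRel_le_bd k) (bd_le_cohenRel k))

end Circle

theorem SimplicialGroup.NormalSub.exists_iso_of_eq {G : SimplicialGroup.{u}} {N N' : G.NormalSub}
    (h : N = N') : ∃ e : N.quotient ≅ N'.quotient, N.proj ≫ e.hom = N'.proj := by
  subst h
  exact ⟨Iso.refl _, Category.comp_id _⟩

theorem theorem6p12 :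
    -- `K(S¹)` is a minimal simplicial group
    SimplicialGroup.IsMinimal KCircle.{u} ∧
    -- it is a quotient of `F(S¹)`
    (∀ n : ℕ, Function.Surjective (circleProj.{u}.app (op ⦋n⦌)).hom) ∧
    -- homomorphisms to minimal simplicial groups factor, uniquely, through it
    (∀ G : SimplicialGroup.{u}, G.IsMinimal → ∀ f : FCircle.{u} ⟶ G,
      ∃! g : KCircle.{u} ⟶ G, circleProj.{u} ≫ g = f) ∧
    -- as a quotient of `F(S¹)`, it is the quotient by the closure of the boundaries
    (∃ e : KCircle.{u} ≅ (SimplicialGroup.boundaryClosure FCircle.{u}).quotient,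
      circleProj.{u} ≫ e.hom = (SimplicialGroup.boundaryClosure FCircle.{u}).proj) :=
  ⟨Circle.facesTrivial_KCircle.isMinimal,
    fun n => (SimplicialGroup.cohenRel _ _).proj_surjective (op ⦋n⦌),
    fun _ hG f => (SimplicialGroup.cohenRel _ _).existsUnique_desc f fun k =>
      (Circle.cohenRel_le_bd k).trans (SimplicialGroup.boundaryClosure_le_ker hG.facesTrivial f k),
    SimplicialGroup.NormalSub.exists_iso_of_eq Circle.cohenRel_eq_bd⟩
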